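/- Let $\mathbb{P}_z$ be a probability distribution on $\mathbb{R}^{n}$ (the law of the final state of an uncertain dynamical system), let $1\le N_i\le N$, and let $\boldsymbol{D}=(\boldsymbol z_1,\dots,\boldsymbol z_N)$ be i.i.d. with law $\mathbb{P}_z$. Fix an integer $d\ge 0$, let $v(x)$ be the vector of all monomials in $x\in\mathbb{R}^{n}$ of degree at most $d$, and for a finite list $T$ of points of $\mathbb{R}^n$ put $$\hat M_T=\frac1{|T|}\sum_{z\in T}v(z)v(z)^\top,\qquad \kappa_T^{-1}(x)=v(x)^\top\hat M_T^{-1}v(x),\qquad S_T=\Big\{x\in\mathbb{R}^{n}:\ \kappa_T^{-1}(x)\le\max_{z\in T}\kappa_T^{-1}(z)\Big\},\qquad L(T)=(S_T,\kappa_T^{-1}),$$ where, if $\hat M_T$ is singular, $\hat M_T^{-1}$ is given by any fixed Borel measurable convention (for instance a pseudo-inverse). Pick-to-Learn (P2L) is run as follows. The first $N_i$ points $D_0$ of $D$ give the initial decision $h_0=L(D_0)$; let $D'$ be the list of the remaining $N-N_i$ points. Start with $T=\emptyset$ and $h=h_0$. While some point of $D'\setminus T$ (list difference, with multiplicities) lies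 outside the set $S$ of the current decision $h=(S,\kappa^{-1})$, append to $T$ the point of $D'\setminus T$ outside $S$ with the largest value of $\kappa^{-1}$, ties being broken by a fixed (Borel measurable) total order on $\mathbb{R}^n$, and update $h\leftarrow L(T)$. At termination return the set $S(D)$ of the current decision and the list $T$. For $\delta\in(0,1)$ let $\bar\varepsilon(k,\delta,M)$ be, for $0\le k<M$, the unique solution $\varepsilon\in[k/M,1]$ of $$\frac{\delta}{M}\sum_{m=k}^{M-1}\frac{\binom mk}{\binom Mk}(1-\varepsilon)^{-(M-m)}=1,$$ and $\bar\varepsilon(M,\delta,M)=1$. Then, for every $\delta\in(0,1)$, $$\mathbb{P}\big\{\mathbb{P}_z[z:\ z\notin S(\boldsymbol D)]\le\bar\varepsilon(|\boldsymbol T|,\delta,N-N_i)\big\}\ \ge\ 1-\delta .$$ The same holds if the initial points are kept in the synthesis at every update, i.e. if $h\leftarrow L(T)$ is replaced by $h\leftarrow L(D_0\cup T)$ (concatenation of lists; the points of $D_0$ are not counted in $|T|$). -/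

import Mathlib

open MeasureTheory ProbabilityTheory

/-! ## The function `ε̄` -/

/-- `Ψ_{k,δ}(ε) = (δ/N) ∑_{m=k}^{N-1} (binom m k / binom N k) (1-ε)^{-(N-m)}`. -/
noncomputable def Psi (k : ℕ) (δ : ℝ) (N : ℕ) (ε : ℝ) : ℝ :=
  δ / N * ∑ m ∈ Finset.Ico k N, (m.choose k : ℝ) / (N.choose k : ℝ) * ((1 - ε) ^ (N - m))⁻¹

theorem choose_ratio_le {k N : ℕ} (hk : k < N) :
    ∀ j : ℕ, j ≤ N - k →
      ((N - j).choose k : ℝ) / (N.choose k : ℝ) ≤ (1 - (k : ℝ) / N) ^ j := by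
  have hN : (0 : ℝ) < N := by exact_mod_cast (by omega : 0 < N)
  have hC : (0 : ℝ) < (N.choose k : ℝ) := by exact_mod_cast Nat.choose_pos hk.le
  have hq : 0 ≤ 1 - (k : ℝ) / N := by
    rw [sub_nonneg, div_le_one hN]; exact_mod_cast hk.le
  intro j
  induction j with
  | zero => intro _; simp [div_self hC.ne']
  | succ j ih =>
    intro hj
    have ih := ih (by omega)
    obtain ⟨a, ha⟩ : ∃ a, N - j = a + 1 := ⟨N - j - 1, by omega⟩
    have ha' : N - (j + 1) = a := by omega
    have hka : k ≤ a := by omega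
    rw [ha] at ih
    rw [ha']
    have key : (a.choose k : ℝ) * (a + 1) = ((a + 1).choose k : ℝ) * (a + 1 - k) := by
      have h1 := Nat.choose_mul_succ_eq a k
      have h2 : ((a + 1 - k : ℕ) : ℝ) = (a : ℝ) + 1 - k := by
        rw [Nat.cast_sub (by omega)]; push_cast; ring
      have h3 : ((a.choose k * (a + 1) : ℕ) : ℝ) = (((a + 1).choose k * (a + 1 - k) : ℕ) : ℝ) := by
        exact_mod_cast h1
      rw [Nat.cast_mul, Nat.cast_mul, h2] at h3
      push_cast at h3
      exact h3
    have ha1 : (0 : ℝ) < (a : ℝ) + 1 := by positivity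
    have e : (a.choose k : ℝ) = ((a + 1).choose k : ℝ) * (1 - k / (a + 1)) := by
      field_simp
      linarith [key]
    have haN : (a : ℝ) + 1 ≤ N := by exact_mod_cast (by omega : a + 1 ≤ N)
    have hle : 1 - (k : ℝ) / (a + 1) ≤ 1 - (k : ℝ) / N := by
      have : (k : ℝ) / N ≤ k / (a + 1) := by gcongr
      linarith
    calc (a.choose k : ℝ) / (N.choose k : ℝ)
        = ((a + 1).choose k : ℝ) / (N.choose k : ℝ) * (1 - k / (a + 1)) := by rw [e]; ring
      _ ≤ ((a + 1).choose k : ℝ) / (N.choose k : ℝ) * (1 - (k : ℝ) / N) := by gcongr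
      _ ≤ (1 - (k : ℝ) / N) ^ j * (1 - (k : ℝ) / N) := by gcongr
      _ = _ := by rw [pow_succ]

theorem Psi_strictMonoOn {k N : ℕ} (hk : k < N) {δ : ℝ} (hδ : 0 < δ) :
    StrictMonoOn (Psi k δ N) (Set.Iio 1) := by
  intro a ha b hb hab
  have ha : a < 1 := ha
  have hb : b < 1 := hb
  have hN : (0 : ℝ) < N := by exact_mod_cast (by omega : 0 < N)
  have hC : (0 : ℝ) < (N.choose k : ℝ) := by exact_mod_cast Nat.choose_pos hk.le
  unfold Psi
  refine mul_lt_mul_of_pos_left ?_ (by positivity)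
  refine Finset.sum_lt_sum_of_nonempty (Finset.nonempty_Ico.2 hk) ?_
  intro m hm
  have hm := Finset.mem_Ico.1 hm
  have hc : (0 : ℝ) < (m.choose k : ℝ) := by exact_mod_cast Nat.choose_pos hm.1
  refine mul_lt_mul_of_pos_left ?_ (by positivity)
  have hb' : 0 < 1 - b := by linarith
  refine inv_strictAnti₀ (by positivity) ?_
  exact pow_lt_pow_left₀ (by linarith) hb'.le (by omega)

theorem Psi_at_ratio_le {k N : ℕ} (hk : k < N) {δ : ℝ} (hδ : 0 < δ) :
    Psi k δ N ((k : ℝ) / N) ≤ δ := by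
  have hN : (0 : ℝ) < N := by exact_mod_cast (by omega : 0 < N)
  have hq : 0 < 1 - (k : ℝ) / N := by
    rw [sub_pos, div_lt_one hN]; exact_mod_cast hk
  have hs : ∑ m ∈ Finset.Ico k N,
      (m.choose k : ℝ) / (N.choose k : ℝ) * ((1 - (k : ℝ) / N) ^ (N - m))⁻¹ ≤ N := by
    calc _ ≤ ∑ m ∈ Finset.Ico k N, (1 : ℝ) := by
          refine Finset.sum_le_sum fun m hm => ?_
          have hm := Finset.mem_Ico.1 hm
          have h := choose_ratio_le hk (N - m) (by omega)
          rw [show N - (N - m) = m by omega] at h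
          rw [← div_eq_mul_inv, div_le_one (by positivity)]
          exact h
      _ = ((N - k : ℕ) : ℝ) := by simp
      _ ≤ N := by exact_mod_cast Nat.sub_le N k
  unfold Psi
  calc _ ≤ δ / N * N := by gcongr
    _ = δ := by field_simp

theorem existsUnique_Psi_eq_one {k N : ℕ} (hk : k < N) {δ : ℝ} (h0 : 0 < δ) (h1 : δ < 1) :
    ∃! ε : ℝ, ε ∈ Set.Ioo (0 : ℝ) 1 ∩ Set.Icc ((k : ℝ) / N) 1 ∧ Psi k δ N ε = 1 := by
  have hN : (0 : ℝ) < N := by exact_mod_cast (by omega : 0 < N)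
  have hC : (0 : ℝ) < (N.choose k : ℝ) := by exact_mod_cast Nat.choose_pos hk.le
  have hc' : (0 : ℝ) < ((N - 1).choose k : ℝ) := by
    exact_mod_cast Nat.choose_pos (by omega : k ≤ N - 1)
  set r : ℝ := ((N - 1).choose k : ℝ) / (N.choose k : ℝ) with hr
  have hr0 : 0 < r := by positivity
  have hr1 : r ≤ 1 - (k : ℝ) / N := by simpa using choose_ratio_le hk 1 (by omega)
  set c : ℝ := δ / N * r with hcdef
  have hc0 : 0 < c := by positivity
  have hδN : δ / N ≤ 1 := by
    rw [div_le_one hN]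
    have : (1 : ℝ) ≤ N := by exact_mod_cast (by omega : 1 ≤ N)
    linarith
  have hc1 : c ≤ r := by
    calc c ≤ 1 * r := by rw [hcdef]; gcongr
      _ = r := one_mul r
  have hb : 1 ≤ Psi k δ N (1 - c) := by
    have hsum : r * c⁻¹ ≤ ∑ m ∈ Finset.Ico k N,
        (m.choose k : ℝ) / (N.choose k : ℝ) * ((1 - (1 - c)) ^ (N - m))⁻¹ := by
      have hmem : N - 1 ∈ Finset.Ico k N := Finset.mem_Ico.2 ⟨by omega, by omega⟩
      have h := Finset.single_le_sum (f := fun m : ℕ =>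
        (m.choose k : ℝ) / (N.choose k : ℝ) * ((1 - (1 - c)) ^ (N - m))⁻¹)
        (fun m _ => by simp only [sub_sub_cancel]; positivity) hmem
      simp only [sub_sub_cancel, show N - (N - 1) = 1 by omega, pow_one] at h
      simpa only [sub_sub_cancel] using h
    have hfac : (0 : ℝ) ≤ δ / N := by positivity
    unfold Psi
    calc (1 : ℝ) = c * c⁻¹ := (mul_inv_cancel₀ hc0.ne').symm
      _ = δ / N * (r * c⁻¹) := by rw [hcdef]; ring
      _ ≤ _ := mul_le_mul_of_nonneg_left hsum hfac
  have hcont : ContinuousOn (Psi k δ N) (Set.Icc ((k : ℝ) / N) (1 - c)) := by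
    unfold Psi
    refine continuousOn_const.mul (continuousOn_finsetSum _ fun m _ => ?_)
    refine continuousOn_const.mul (ContinuousOn.inv₀ (by fun_prop) ?_)
    intro x hx
    have : 0 < 1 - x := by linarith [hx.2]
    positivity
  have ha : Psi k δ N ((k : ℝ) / N) ≤ δ := Psi_at_ratio_le hk h0
  obtain ⟨ε, hε, hε1⟩ := intermediate_value_Icc (by linarith) hcont
    (⟨by linarith, hb⟩ : (1 : ℝ) ∈ Set.Icc _ _)
  have hk0 : (0 : ℝ) ≤ (k : ℝ) / N := by positivity
  have hne : ε ≠ (k : ℝ) / N := by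
    intro h
    rw [h] at hε1
    linarith
  have hlt : (k : ℝ) / N < ε := lt_of_le_of_ne hε.1 (Ne.symm hne)
  have hε2 : ε < 1 := by linarith [hε.2]
  refine ⟨ε, ⟨⟨⟨by linarith, hε2⟩, hε.1, hε2.le⟩, hε1⟩, ?_⟩
  rintro y ⟨hy, hy1⟩
  exact (Psi_strictMonoOn hk h0).injOn hy.1.2 hε2 (hy1.trans hε1.symm)

open Classical in
/-- `ε̄(k,δ,N)`: for `k < N` the unique solution of `Ψ_{k,δ}(ε) = 1` in `[k/N, 1]`
(`Ψ_{k,δ}` being a function on `(0,1)`), and `1` for `k = N`. -/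
noncomputable def epsBar (k : ℕ) (δ : ℝ) (N : ℕ) : ℝ :=
  if h : k < N ∧ 0 < δ ∧ δ < 1 then
    (existsUnique_Psi_eq_one h.1 h.2.1 h.2.2).exists.choose
  else 1

/-! ## The meta-algorithm P2L

`L : List Z → H` is the synthesis algorithm, `φ : H → Z → Prop` the property, and `le h y z` says
that, for the decision `h`, the degree of dissatisfaction of `z` is at least that of `y`
(a total order on the unsatisfied points).  -/

open Classical in
/-- The maximum, in the total order `le`, of the nonempty list `a :: l`. -/
noncomputable def maxOf {Z : Type*} (le : Z → Z → Prop) (a : Z) (l : List Z) : Z :=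
  l.foldl (fun b c => if le b c then c else b) a

open Classical in
theorem maxOf_mem {Z : Type*} (le : Z → Z → Prop) (a : Z) (l : List Z) :
    maxOf le a l ∈ a :: l := by
  induction l generalizing a with
  | nil => simp [maxOf]
  | cons b l ih =>
    have h := ih (if le a b then b else a)
    have e : maxOf le a (b :: l) = maxOf le (if le a b then b else a) l := rfl
    rw [e]
    by_cases hab : le a b
    · simp only [hab, if_true] at h ⊢
      exact List.mem_cons_of_mem _ h
    · simp only [hab, if_false] at h ⊢
      rcases List.mem_cons.1 h with h | h
      · simp [h]
      · simp [h]

open Classical in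
/-- The sublist of the points of `D \ T` at which `φ` fails for the decision `h`;
`D \ T` is the list difference, with multiplicities. -/
noncomputable def unsat {H Z : Type*} (φ : H → Z → Prop) (D : List Z) (h : H) (T : List Z) :
    List Z :=
  (D.diff T).filter (fun z => ¬ φ h z)

theorem diff_append_length_lt {H Z : Type*} (φ : H → Z → Prop) (le : H → Z → Z → Prop)
    (D : List Z) (h : H) (T : List Z) (a : Z) (l : List Z) (hu : unsat φ D h T = a :: l) :
    letI := Classical.decEq Z
    (D.diff (T ++ [maxOf (le h) a l])).length < (D.diff T).length := by
  classical
  have hm : maxOf (le h) a l ∈ D.diff T := by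
    have h1 := maxOf_mem (le h) a l
    rw [← hu, unsat] at h1
    have h2 := (List.mem_filter.1 h1).1
    convert h2
  have e : (D.diff (T ++ [maxOf (le h) a l])) = (D.diff T).erase (maxOf (le h) a l) := by
    rw [List.diff_append, List.diff_cons, List.diff_nil]
  have hlt : ((D.diff T).erase (maxOf (le h) a l)).length < (D.diff T).length := by
    rw [List.length_erase_of_mem hm]
    have := List.length_pos_of_mem hm
    omega
  rw [← e] at hlt
  convert hlt

open Classical in
/-- The main loop: while some point of `D \ T` is unsatisfied, append the most unsatisfied one
to `T` and set `h ← L T`; then return `(h, T)`. -/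
noncomputable def p2lLoop {H Z : Type*} (L : List Z → H) (φ : H → Z → Prop)
    (le : H → Z → Z → Prop) (D : List Z) (h : H) (T : List Z) : H × List Z :=
  match _hu : unsat φ D h T with
  | [] => (h, T)
  | a :: l => p2lLoop L φ le D (L (T ++ [maxOf (le h) a l])) (T ++ [maxOf (le h) a l])
termination_by (D.diff T).length
decreasing_by
  have := diff_append_length_lt φ le D h T a l _hu
  convert this

/-- P2L: start from `T = ∅` and `h = h₀`. -/
noncomputable def p2l {H Z : Type*} (L : List Z → H) (φ : H → Z → Prop)
    (le : H → Z → Z → Prop) (h₀ : H) (D : List Z) : H × List Z :=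
  p2lLoop L φ le D h₀ []

/-! ## The empirical inverse Christoffel function -/

/-- Exponents of the monomials in `n` variables of degree at most `d`. -/
abbrev MonoIdx (n d : ℕ) : Type := {m : Fin n → Fin (d + 1) // ∑ i, (m i : ℕ) ≤ d}

/-- The vector `v(x)` of all monomials of degree at most `d`. -/
def monoVec {n : ℕ} (d : ℕ) (x : Fin n → ℝ) : MonoIdx n d → ℝ :=
  fun m => ∏ i, x i ^ (m.1 i : ℕ)

/-- The matrix of empirical moments `M̂ = |T|⁻¹ ∑_{z ∈ T} v(z) v(z)ᵀ`. -/
noncomputable def momentMatrix {n : ℕ} (d : ℕ) (T : List (Fin n → ℝ)) :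
    Matrix (MonoIdx n d) (MonoIdx n d) ℝ :=
  (1 / (T.length : ℝ)) • (T.map fun z => Matrix.vecMulVec (monoVec d z) (monoVec d z)).sum

/-- The empirical inverse Christoffel function `κ⁻¹(x) = v(x)ᵀ M̂⁻¹ v(x)`. The argument `inv` is
matrix inversion, together with a convention for singular matrices. -/
noncomputable def invChristoffel {n d : ℕ}
    (inv : Matrix (MonoIdx n d) (MonoIdx n d) ℝ → Matrix (MonoIdx n d) (MonoIdx n d) ℝ)
    (T : List (Fin n → ℝ)) (x : Fin n → ℝ) : ℝ :=
  monoVec d x ⬝ᵥ Matrix.mulVec (inv (momentMatrix d T)) (monoVec d x)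

/-- A decision `h = (S, κ⁻¹)`. -/
structure ReachDecision (n : ℕ) where
  /-- the reachable set -/
  S : Set (Fin n → ℝ)
  /-- the empirical inverse Christoffel function -/
  kappaInv : (Fin n → ℝ) → ℝ

/-- The synthesis algorithm: `T ↦ (S, κ⁻¹)`, where `S` is the sublevel set of `κ⁻¹` at the level
`α = max_{z ∈ T} κ⁻¹(z)`. -/
noncomputable def christoffelSynth {n d : ℕ}
    (inv : Matrix (MonoIdx n d) (MonoIdx n d) ℝ → Matrix (MonoIdx n d) (MonoIdx n d) ℝ)
    (T : List (Fin n → ℝ)) : ReachDecision n where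
  S := {x | (invChristoffel inv T x : WithBot ℝ) ≤ (T.map (invChristoffel inv T)).maximum}
  kappaInv := invChristoffel inv T

/-- The property: `z` lies in the set `S`. -/
def inReachSet {n : ℕ} (h : ReachDecision n) (z : Fin n → ℝ) : Prop := z ∈ h.S

/-- The degree of dissatisfaction is `κ⁻¹(z)`, ties being broken by the preference `pref`. -/
def dissatLE {n : ℕ} (pref : (Fin n → ℝ) → (Fin n → ℝ) → Prop) (h : ReachDecision n)
    (y z : Fin n → ℝ) : Prop :=
  h.kappaInv y < h.kappaInv z ∨ (h.kappaInv y = h.kappaInv z ∧ pref y z)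

/-- P2L for data-driven reachability on the dataset `D`. The first `Nᵢ` points determine
`h₀`, and the loop is run on the remaining ones. With `keep = false` the update is `h ← L(T)`;
with `keep = true` the initial points stay in the synthesis list, as prior information, at every
update (they never belong to `T`). -/
noncomputable def p2lReach {n d : ℕ}
    (inv : Matrix (MonoIdx n d) (MonoIdx n d) ℝ → Matrix (MonoIdx n d) (MonoIdx n d) ℝ)
    (pref : (Fin n → ℝ) → (Fin n → ℝ) → Prop) (keep : Bool) (Ni : ℕ)
    (D : List (Fin n → ℝ)) : ReachDecision n × List (Fin n → ℝ) :=
  p2l (fun T => christoffelSynth inv (if keep then D.take Ni ++ T else T))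
    inReachSet (dissatLE pref) (christoffelSynth inv (D.take Ni)) (D.drop Ni)

/-!
The points picked by P2L form a *greedy run*: each pick is the worst of the sample points outside
the current region, and at the end no sample point is outside. Each region `S_T` contains the
points of `T` it is built from, so picks never repeat, the list difference in the algorithm plays
no role, and the run is determined by the set of sample values (`p2l_isGreedyRun`,
`IsGreedyRun.unique`). The initial points are fixed by conditioning; after that they are only a
parameter of the decisions, and both update rules are covered at once.

If the sample points are almost surely distinct, the picks are `t = w ∘ σ` for exactly one
injection `σ : Fin k ↪ Fin m` of indices, and this happens iff `t` is a greedy run on its own and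
every other sample point lies in the set `A t` of points whose presence does not alter the run
(`unchanging`). With `q t = P (A t)`, the event of a given `σ` therefore has probability
`∫ q ^ (m - k)` over the self-consistent `k`-tuples (`measure_embEvent`). The events are disjoint,
which for every sample size `m` gives
`∑ k, m.descFactorial k * ∫ q ^ (m - k) ≤ 1`.
The event that the risk exceeds `ε̄` has probability at most
`∑ k < M, M.descFactorial k * ∫ 1_{ε̄ < risk} q ^ (M - k)`, and since the risk is at most `1 - q`,
the definition of `ε̄` says precisely that this is dominated by the average over `m < M` of the
left sides above, times `δ` (`descFactorial_mul_pow_le`, `measure_isGreedyRun_risk_le`).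

If `P` has atoms, sample points may coincide, and several `σ` describe the same run. The points
are then given independent uniform labels in `[0, 1]`, by which equal points are ordered. The
labelled sample has almost surely no repetitions, and forgetting the labels changes neither the
run nor its risk (`measure_isGreedyRun_risk_le_of_measurableSet`).
-/

/-! ### Greedy runs and P2L -/

section Deterministic

variable {Z : Type*}

/-- `T` is a list of greedy picks from `V`: each entry `x`, preceded in `T` by the list `S`, lies
in `V` and outside `R S`, and is `le S`-maximal among the points of `V` outside `R S`. Here `R S`
stands for the region of the decision reached after the picks `S`. -/
def IsGreedy (R : List Z → Set Z) (le : List Z → Z → Z → Prop) (V : Set Z) (T : List Z) : Prop :=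
  ∀ S x r, T = S ++ x :: r → x ∈ V ∧ x ∉ R S ∧ ∀ z ∈ V, z ∉ R S → le S z x

/-- A greedy list of picks that has come to its end: no point of `V` lies outside `R T`. -/
def IsGreedyRun (R : List Z → Set Z) (le : List Z → Z → Z → Prop) (V : Set Z) (T : List Z) :
    Prop :=
  IsGreedy R le V T ∧ V ⊆ R T

variable {R : List Z → Set Z} {le : List Z → Z → Z → Prop} {V : Set Z}

theorem isGreedy_nil : IsGreedy R le V [] := by
  intro S x r h
  simp at h

theorem IsGreedy.snoc {T : List Z} (hT : IsGreedy R le V T) {x : Z} (hxV : x ∈ V)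
    (hxR : x ∉ R T) (hmax : ∀ z ∈ V, z ∉ R T → le T z x) : IsGreedy R le V (T ++ [x]) := by
  intro S y r h
  rcases List.eq_nil_or_concat' r with rfl | ⟨r', b, rfl⟩
  · obtain ⟨rfl, h2⟩ := List.append_inj' h rfl
    obtain rfl : x = y := by simpa using h2
    exact ⟨hxV, hxR, hmax⟩
  · refine hT S y r' ?_
    have h' : T ++ [x] = (S ++ y :: r') ++ [b] := by simpa using h
    exact (List.append_inj' h' rfl).1

theorem IsGreedy.of_append {S r : List Z} (h : IsGreedy R le V (S ++ r)) :
    IsGreedy R le V S := by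
  intro S' x r' e
  exact h S' x (r' ++ r) (by simp [e])

/-- Two greedy lists of picks from the same points are prefixes of one another. -/
theorem IsGreedy.prefix_or_prefix (hanti : ∀ S y z, le S y z → le S z y → y = z)
    {T T' : List Z} (hT : IsGreedy R le V T) (hT' : IsGreedy R le V T') :
    T <+: T' ∨ T' <+: T := by
  induction T using List.reverseRecOn with
  | nil => exact Or.inl List.nil_prefix
  | append_singleton S x ih =>
    rcases ih hT.of_append with ⟨r, rfl⟩ | h
    · cases r with
      | nil => exact Or.inr ⟨[x], by simp⟩
      | cons y r =>
        obtain ⟨hx1, hx2, hx3⟩ := hT S x [] rfl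
        obtain ⟨hy1, hy2, hy3⟩ := hT' S y r rfl
        obtain rfl : x = y := hanti S x y (hy3 x hx1 hx2) (hx3 y hy1 hy2)
        exact Or.inl ⟨r, by simp⟩
    · exact Or.inr (h.trans (List.prefix_append _ _))

theorem IsGreedyRun.unique (hanti : ∀ S y z, le S y z → le S z y → y = z)
    {T T' : List Z} (hT : IsGreedyRun R le V T) (hT' : IsGreedyRun R le V T') : T = T' := by
  have aux : ∀ {T T' : List Z}, IsGreedyRun R le V T → IsGreedyRun R le V T' → T <+: T' →
      T = T' := by
    rintro T T' hT hT' ⟨r, rfl⟩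
    cases r with
    | nil => simp
    | cons y r =>
      obtain ⟨h1, h2, -⟩ := hT'.1 T y r rfl
      exact absurd (hT.2 h1) h2
  rcases hT.1.prefix_or_prefix hanti hT'.1 with h | h
  · exact aux hT hT' h
  · exact (aux hT' hT h).symm

theorem IsGreedy.nodup (hR : ∀ T, ∀ x ∈ T, x ∈ R T) {T : List Z} (hT : IsGreedy R le V T) :
    T.Nodup := by
  induction T using List.reverseRecOn with
  | nil => simp
  | append_singleton S x ih =>
    have h := (hT S x [] rfl).2.1
    rw [← List.concat_eq_append]
    exact (ih hT.of_append).concat fun hx => h (hR S x hx)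

theorem IsGreedy.mem {T : List Z} (hT : IsGreedy R le V T) {x : Z} (hx : x ∈ T) : x ∈ V := by
  obtain ⟨S, r, e⟩ := List.append_of_mem hx
  exact (hT S x r e).1

theorem le_maxOf {r : Z → Z → Prop} (hrefl : ∀ x, r x x)
    (htrans : ∀ x y z, r x y → r y z → r x z) (htot : ∀ x y, r x y ∨ r y x) (a : Z) (l : List Z) :
    ∀ x ∈ a :: l, r x (maxOf r a l) := by
  classical
  induction l generalizing a with
  | nil => simpa [maxOf] using hrefl a
  | cons b l ih =>
    have e : maxOf r a (b :: l) = maxOf r (if r a b then b else a) l := rfl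
    rw [e]
    have h := ih (if r a b then b else a)
    have h0 := h _ List.mem_cons_self
    intro x hx
    rcases List.mem_cons.1 hx with rfl | hx
    · refine htrans _ _ _ ?_ h0
      split_ifs with hab
      · exact hab
      · exact hrefl _
    · rcases List.mem_cons.1 hx with rfl | hx
      · refine htrans _ _ _ ?_ h0
        split_ifs with hab
        · exact hrefl _
        · exact (htot _ _).resolve_left hab
      · exact h x (List.mem_cons_of_mem _ hx)

/-- The decision of P2L after the picks `T`: `h₀` before the first pick, and `L T` later. -/
def decisionAfter {H : Type*} (L : List Z → H) (h₀ : H) : List Z → H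
  | [] => h₀
  | a :: T => L (a :: T)

theorem decisionAfter_of_ne_nil {H : Type*} (L : List Z → H) (h₀ : H) {T : List Z}
    (hT : T ≠ []) : decisionAfter L h₀ T = L T := by
  cases T with
  | nil => exact absurd rfl hT
  | cons a T => rfl

open Classical in
theorem p2lLoop_isGreedyRun {H : Type*} (L : List Z → H) (φ : H → Z → Prop)
    (le : H → Z → Z → Prop) (h₀ : H) (D : List Z)
    (hrefl : ∀ h x, le h x x) (htrans : ∀ h x y z, le h x y → le h y z → le h x z)
    (htot : ∀ h x y, le h x y ∨ le h y x)
    (hφ : ∀ T, ∀ x ∈ T, φ (L T) x) (n : ℕ) (T : List Z) (hn : (D.diff T).length = n)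
    (hT : IsGreedy (fun S => {z | φ (decisionAfter L h₀ S) z})
      (fun S => le (decisionAfter L h₀ S)) {z | z ∈ D} T) :
    ∃ T', p2lLoop L φ le D (decisionAfter L h₀ T) T = (decisionAfter L h₀ T', T') ∧
      IsGreedyRun (fun S => {z | φ (decisionAfter L h₀ S) z})
        (fun S => le (decisionAfter L h₀ S)) {z | z ∈ D} T' := by
  induction n using Nat.strong_induction_on generalizing T with
  | _ n ih =>
    -- Points already picked satisfy the current decision, so that `D \ T` and `D` have the same
    -- unsatisfied points.
    have hmem : ∀ z, z ∈ unsat φ D (decisionAfter L h₀ T) T ↔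
        z ∈ D ∧ ¬ φ (decisionAfter L h₀ T) z := by
      intro z
      rw [unsat, List.mem_filter]
      simp only [decide_eq_true_eq]
      refine ⟨fun h => ⟨List.diff_subset _ _ h.1, h.2⟩, fun h => ⟨?_, h.2⟩⟩
      refine List.mem_diff_of_mem h.1 fun hzT => h.2 ?_
      rw [decisionAfter_of_ne_nil L h₀ (List.ne_nil_of_mem hzT)]
      exact hφ T z hzT
    rw [p2lLoop]
    split
    · next hu =>
      refine ⟨T, rfl, hT, fun z hz => ?_⟩
      by_contra hcon
      have := (hmem z).2 ⟨hz, hcon⟩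
      rw [hu] at this
      simp at this
    · next a l hu =>
      have hlt := diff_append_length_lt φ le D (decisionAfter L h₀ T) T a l hu
      set x := maxOf (le (decisionAfter L h₀ T)) a l with hx
      have hxm := maxOf_mem (le (decisionAfter L h₀ T)) a l
      rw [← hu, ← hx, hmem] at hxm
      have hmax := le_maxOf (hrefl (decisionAfter L h₀ T)) (htrans _) (htot _) a l
      rw [← hu] at hmax
      have hg := hT.snoc (x := x) hxm.1 hxm.2 fun z hz hzR => hmax z ((hmem z).2 ⟨hz, hzR⟩)
      rw [← decisionAfter_of_ne_nil L h₀ (T := T ++ [x]) (by simp)]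
      exact ih _ (by rw [← hn]; convert hlt) (T ++ [x]) rfl hg

/-- The output of P2L is a complete greedy run together with the decision it leads to, provided
that every synthesised decision satisfies the points it is synthesised from. -/
theorem p2l_isGreedyRun {H : Type*} (L : List Z → H) (φ : H → Z → Prop)
    (le : H → Z → Z → Prop) (h₀ : H) (D : List Z)
    (hrefl : ∀ h x, le h x x) (htrans : ∀ h x y z, le h x y → le h y z → le h x z)
    (htot : ∀ h x y, le h x y ∨ le h y x) (hφ : ∀ T, ∀ x ∈ T, φ (L T) x) :
    ∃ T, p2l L φ le h₀ D = (decisionAfter L h₀ T, T) ∧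
      IsGreedyRun (fun S => {z | φ (decisionAfter L h₀ S) z})
        (fun S => le (decisionAfter L h₀ S)) {z | z ∈ D} T :=
  p2lLoop_isGreedyRun L φ le h₀ D hrefl htrans htot hφ _ [] rfl isGreedy_nil

theorem exists_isGreedyRun (hrefl : ∀ S x, le S x x)
    (htrans : ∀ S x y z, le S x y → le S y z → le S x z)
    (htot : ∀ S x y, le S x y ∨ le S y x) (hR : ∀ T, ∀ x ∈ T, x ∈ R T) (D : List Z) :
    ∃ T, IsGreedyRun R le {z | z ∈ D} T := by
  obtain ⟨T, -, hT⟩ := p2l_isGreedyRun (H := List Z) (fun T => T) (fun T z => z ∈ R T) le [] D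
    hrefl htrans htot hR
  have e : ∀ S : List Z, decisionAfter (fun T : List Z => T) [] S = S := by
    intro S
    cases S <;> rfl
  simp only [e] at hT
  exact ⟨T, hT⟩

/-- `IsGreedy` for a list given by a function on `Fin k`. -/
theorem isGreedy_ofFn {k : ℕ} {t : Fin k → Z} :
    IsGreedy R le V (List.ofFn t) ↔
      ∀ j : Fin k, t j ∈ V ∧ t j ∉ R ((List.ofFn t).take j) ∧
        ∀ z ∈ V, z ∉ R ((List.ofFn t).take j) → le ((List.ofFn t).take j) z (t j) := by
  constructor
  · intro h j
    refine h _ (t j) ((List.ofFn t).drop (j + 1)) ?_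
    conv_lhs => rw [← List.take_append_drop (j : ℕ) (List.ofFn t)]
    rw [List.drop_eq_getElem_cons (by simp)]
    simp
  · intro h S x r e
    have hl : S.length < k := by
      have := congrArg List.length e
      simp at this
      omega
    have hx : x = t ⟨S.length, hl⟩ := by
      have h1 : (List.ofFn t)[S.length]'(by simpa using hl) = x := by simp [e]
      rw [← h1]
      simp
    have hS : S = (List.ofFn t).take S.length := by rw [e]; simp
    have := h ⟨S.length, hl⟩
    simp only [← hS, ← hx] at this
    exact this

end Deterministic

/-! ### The dual inequality behind `ε̄` -/

theorem epsBar_of_not_lt {k M : ℕ} (δ : ℝ) (h : ¬ k < M) : epsBar k δ M = 1 := by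
  rw [epsBar, dif_neg (fun h' => h h'.1)]

theorem epsBar_spec {k M : ℕ} {δ : ℝ} (hk : k < M) (h0 : 0 < δ) (h1 : δ < 1) :
    (epsBar k δ M ∈ Set.Ioo (0 : ℝ) 1 ∩ Set.Icc ((k : ℝ) / M) 1) ∧
      Psi k δ M (epsBar k δ M) = 1 := by
  rw [epsBar, dif_pos ⟨hk, h0, h1⟩]
  exact (existsUnique_Psi_eq_one hk h0 h1).exists.choose_spec

/-- Dual feasibility of the constant weights `δ / M`: above the level `ε̄`, the sum defining
`Ψ` is at least `1`. It is stated with falling factorials, which count injections, and in terms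
of the probability `q` of leaving a run unchanged. -/
theorem descFactorial_mul_pow_le {k M : ℕ} {δ q : ℝ} (hk : k < M) (h0 : 0 < δ) (h1 : δ < 1)
    (hq : 0 ≤ q) (hε : epsBar k δ M < 1 - q) :
    (M.descFactorial k : ℝ) * q ^ (M - k) ≤
      δ / M * ∑ m ∈ Finset.Ico k M, (m.descFactorial k : ℝ) * q ^ (m - k) := by
  have hM : (0 : ℝ) < M := by exact_mod_cast (by omega : 0 < M)
  have hRHS : 0 ≤ δ / M * ∑ m ∈ Finset.Ico k M, (m.descFactorial k : ℝ) * q ^ (m - k) := by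
    positivity
  rcases hq.eq_or_lt with rfl | hq0
  · rwa [zero_pow (by omega), mul_zero]
  have hs := epsBar_spec hk h0 h1
  have hlt : 1 < Psi k δ M (1 - q) := by
    have h := Psi_strictMonoOn hk h0 hs.1.1.2 (show 1 - q < 1 by linarith) hε
    rwa [hs.2] at h
  have hC : (0 : ℝ) < (M.choose k : ℝ) := by exact_mod_cast Nat.choose_pos hk.le
  have hd : (0 : ℝ) ≤ (M.descFactorial k : ℝ) * q ^ (M - k) := by positivity
  calc (M.descFactorial k : ℝ) * q ^ (M - k)
      = (M.descFactorial k : ℝ) * q ^ (M - k) * 1 := (mul_one _).symm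
    _ ≤ (M.descFactorial k : ℝ) * q ^ (M - k) * Psi k δ M (1 - q) := by gcongr
    _ = _ := by
      rw [Psi, mul_left_comm, Finset.mul_sum]
      congr 1
      refine Finset.sum_congr rfl fun m hm => ?_
      have hm := Finset.mem_Ico.1 hm
      rw [show M - k = (m - k) + (M - m) by omega, pow_add,
        Nat.descFactorial_eq_factorial_mul_choose, Nat.descFactorial_eq_factorial_mul_choose]
      push_cast
      rw [sub_sub_cancel]
      field_simp

/-! ### Splitting product measures -/

section Product

variable {Z : Type*} [MeasurableSpace Z]

/-- A finite product of copies of one measure splits along a decomposition of the index set. -/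
theorem measurePreserving_pi_split {α β γ : Type*} [Fintype α] [Fintype β] [Fintype γ]
    (e : α ⊕ β ≃ γ) (P : Measure Z) [SigmaFinite P] :
    MeasurePreserving (fun w : γ → Z => ((fun a => w (e (.inl a))), fun b => w (e (.inr b))))
      (Measure.pi fun _ => P) ((Measure.pi fun _ => P).prod (Measure.pi fun _ => P)) :=
  (measurePreserving_sumPiEquivProdPi fun _ : α ⊕ β => P).comp
    (measurePreserving_arrowCongr' (fun _ : γ => P) (fun _ : α ⊕ β => P) e.symm
      (MeasurableEquiv.refl Z) fun _ => MeasurePreserving.id P)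

/-- The event that the sample points with index in the image of `σ` form a tuple `t` in `B`,
while all the others lie in `A t`. -/
def embEvent {k m : ℕ} (σ : Fin k ↪ Fin m) (B : Set (Fin k → Z)) (A : (Fin k → Z) → Set Z) :
    Set (Fin m → Z) :=
  {w | w ∘ σ ∈ B ∧ ∀ i ∉ Set.range σ, w i ∈ A (w ∘ σ)}

theorem measurableSet_embEvent {k m : ℕ} (σ : Fin k ↪ Fin m) {B : Set (Fin k → Z)}
    (hB : MeasurableSet B) {A : (Fin k → Z) → Set Z}
    (hA : MeasurableSet {p : (Fin k → Z) × Z | p.2 ∈ A p.1}) :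
    MeasurableSet (embEvent σ B A) := by
  have hσ : Measurable fun w : Fin m → Z => w ∘ σ :=
    measurable_pi_lambda _ fun j => measurable_pi_apply _
  simp only [embEvent, Set.ofPred_and, Set.ofPred_forall]
  refine (hσ hB).inter ?_
  refine MeasurableSet.iInter fun i => MeasurableSet.iInter fun _ => ?_
  exact (hσ.prodMk (measurable_pi_apply i)) hA

/-- Given the tuple `t` at the indices in the image of `σ`, the other points are independent and
each lies in `A t` with probability `P (A t)`. -/
theorem measure_embEvent {k m : ℕ} (P : Measure Z) [IsProbabilityMeasure P] (σ : Fin k ↪ Fin m)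
    {B : Set (Fin k → Z)} (hB : MeasurableSet B) {A : (Fin k → Z) → Set Z}
    (hA : MeasurableSet {p : (Fin k → Z) × Z | p.2 ∈ A p.1}) :
    Measure.pi (fun _ : Fin m => P) (embEvent σ B A) =
      ∫⁻ t in B, P (A t) ^ (m - k) ∂(Measure.pi fun _ : Fin k => P) := by
  classical
  let e : Fin k ⊕ ↥(Set.range σ)ᶜ ≃ Fin m :=
    (Equiv.sumCongr (Equiv.ofInjective σ σ.injective) (Equiv.refl _)).trans
      (Equiv.Set.sumCompl (Set.range σ))
  have hcard : Fintype.card ↥(Set.range σ)ᶜ = m - k := by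
    have := Fintype.card_congr e
    simp only [Fintype.card_sum, Fintype.card_fin] at this
    omega
  let F : Set ((Fin k → Z) × (↥(Set.range σ)ᶜ → Z)) := {p | p.1 ∈ B ∧ ∀ i, p.2 i ∈ A p.1}
  have hF : MeasurableSet F := by
    simp only [F, Set.ofPred_and, Set.ofPred_forall]
    refine (measurable_fst hB).inter ?_
    refine MeasurableSet.iInter fun i => ?_
    have hi : Measurable fun p : (Fin k → Z) × (↥(Set.range σ)ᶜ → Z) => (p.1, p.2 i) :=
      measurable_fst.prodMk ((measurable_pi_apply i).comp measurable_snd)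
    exact hi hA
  have hpre : embEvent σ B A = (fun w : Fin m → Z =>
      ((fun a => w (e (.inl a))), fun b => w (e (.inr b)))) ⁻¹' F := by
    ext w
    simp only [embEvent, Set.mem_ofPred_eq, Set.mem_preimage, F]
    refine and_congr Iff.rfl ⟨fun h i => h i.1 i.2, fun h i hi => h ⟨i, hi⟩⟩
  rw [hpre, (measurePreserving_pi_split e P).measure_preimage hF.nullMeasurableSet,
    Measure.prod_apply hF, ← lintegral_indicator hB]
  refine lintegral_congr fun t => ?_
  by_cases ht : t ∈ B
  · have : Prod.mk t ⁻¹' F = Set.pi Set.univ fun _ => A t := by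
      ext v
      simp [F, ht]
    rw [this, Measure.pi_pi, Set.indicator_of_mem ht]
    simp [hcard]
  · have : Prod.mk t ⁻¹' F = ∅ := by
      ext v
      simp [F, ht]
    rw [this, Set.indicator_of_notMem ht, measure_empty]

end Product

/-! ### The bound for samples without repetitions -/

section Bound

variable {Z : Type*} {R : List Z → Set Z} {le : List Z → Z → Z → Prop}

/-- The `k`-tuples that form a greedy list of picks from their own entries. -/
def selfGreedy (R : List Z → Set Z) (le : List Z → Z → Z → Prop) (k : ℕ) : Set (Fin k → Z) :=
  {t | IsGreedy R le (Set.range t) (List.ofFn t)}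

/-- The points whose presence in the sample leaves the run with picks `t` unchanged: those in the
final region which, at each step, were in the current region or strictly below the pick. -/
def unchanging (R : List Z → Set Z) (le : List Z → Z → Z → Prop) (k : ℕ) (t : Fin k → Z) :
    Set Z :=
  {z | z ∈ R (List.ofFn t) ∧ ∀ j : Fin k,
    z ∈ R ((List.ofFn t).take j) ∨ ¬ le ((List.ofFn t).take j) (t j) z}

theorem notMem_unchanging (hrefl : ∀ S x, le S x x) {k : ℕ} {t : Fin k → Z}
    (ht : t ∈ selfGreedy R le k) (j : Fin k) : t j ∉ unchanging R le k t := by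
  intro h
  rcases h.2 j with h | h
  · exact ((isGreedy_ofFn.1 ht) j).2.1 h
  · exact h (hrefl _ _)

theorem isGreedyRun_of_mem_embEvent (htot : ∀ S x y, le S x y ∨ le S y x)
    (hR : ∀ T, ∀ x ∈ T, x ∈ R T) {k m : ℕ} {σ : Fin k ↪ Fin m} {w : Fin m → Z}
    (hw : w ∈ embEvent σ (selfGreedy R le k) (unchanging R le k)) :
    IsGreedyRun R le (Set.range w) (List.ofFn (w ∘ σ)) := by
  obtain ⟨hG, hA⟩ := hw
  have hG' := isGreedy_ofFn.1 hG
  refine ⟨isGreedy_ofFn.2 fun j => ⟨⟨σ j, rfl⟩, (hG' j).2.1, ?_⟩, ?_⟩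
  · rintro _ ⟨i, rfl⟩ hi
    by_cases hσ : i ∈ Set.range σ
    · obtain ⟨i, rfl⟩ := hσ
      exact (hG' j).2.2 _ ⟨i, rfl⟩ hi
    · exact (htot _ _ _).resolve_right (((hA i hσ).2 j).resolve_left hi)
  · rintro _ ⟨i, rfl⟩
    by_cases hσ : i ∈ Set.range σ
    · obtain ⟨i, rfl⟩ := hσ
      exact hR _ _ (List.mem_ofFn.2 ⟨i, rfl⟩)
    · exact (hA i hσ).1

theorem embEvent_disjoint (hrefl : ∀ S x, le S x x)
    (hanti : ∀ S y z, le S y z → le S z y → y = z)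
    (htot : ∀ S x y, le S x y ∨ le S y x) (hR : ∀ T, ∀ x ∈ T, x ∈ R T) {m : ℕ} :
    Pairwise (Function.onFun Disjoint fun s : Σ k : Fin (m + 1), Fin k ↪ Fin m =>
      embEvent s.2 (selfGreedy R le s.1) (unchanging R le s.1)) := by
  rintro ⟨k, σ⟩ ⟨k', σ'⟩ hne
  rw [Function.onFun, Set.disjoint_left]
  intro w hw hw'
  apply hne
  have hrun := isGreedyRun_of_mem_embEvent htot hR hw
  have e := hrun.unique hanti (isGreedyRun_of_mem_embEvent htot hR hw')
  obtain rfl : k = k' := by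
    have := congrArg List.length e
    simpa [Fin.ext_iff] using this
  have e' : w ∘ σ = w ∘ σ' := List.ofFn_injective e
  have hinj : Function.Injective (w ∘ σ) := List.nodup_ofFn.1 (hrun.1.nodup hR)
  have hσ : σ = σ' := by
    ext1 j
    have hj : w (σ j) = w (σ' j) := congrFun e' j
    by_cases hr : σ' j ∈ Set.range σ
    · obtain ⟨i, hi⟩ := hr
      have : (w ∘ σ) i = (w ∘ σ) j := by simp only [Function.comp_apply, hi, hj]
      rw [← hi, hinj this]
    · have h1 := hw.2 _ hr
      rw [← hj] at h1
      exact absurd h1 (notMem_unchanging hrefl hw.1 j)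
  rw [hσ]

/-- A run on a sample without repetitions is witnessed by an injection of indices. -/
theorem exists_mem_embEvent (hanti : ∀ S y z, le S y z → le S z y → y = z)
    (hR : ∀ T, ∀ x ∈ T, x ∈ R T) {m : ℕ} {w : Fin m → Z} (hw : Function.Injective w)
    {T : List Z} (hT : IsGreedyRun R le (Set.range w) T) :
    ∃ (k : ℕ) (σ : Fin k ↪ Fin m), T = List.ofFn (w ∘ σ) ∧
      w ∈ embEvent σ (selfGreedy R le k) (unchanging R le k) := by
  have hex : ∀ j : Fin T.length, ∃ i, w i = T.get j := fun j => hT.1.mem (T.get_mem j)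
  choose s hs using hex
  have hsT : T = List.ofFn (w ∘ s) := by
    rw [show w ∘ s = T.get from funext hs, List.ofFn_get]
  have hinj : Function.Injective (w ∘ s) := by
    rw [← List.nodup_ofFn, ← hsT]
    exact hT.1.nodup hR
  clear hs
  generalize T.length = k at s hsT hinj
  subst hsT
  have hG := isGreedy_ofFn.1 hT.1
  refine ⟨k, ⟨s, hinj.of_comp⟩, rfl, isGreedy_ofFn.2 fun j => ⟨⟨j, rfl⟩, (hG j).2.1, ?_⟩, ?_⟩
  · rintro _ ⟨i, rfl⟩ hi
    exact (hG j).2.2 _ ⟨s i, rfl⟩ hi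
  · intro i hi
    refine ⟨hT.2 ⟨i, rfl⟩, fun j => ?_⟩
    by_contra! hcon
    have := hanti _ _ _ hcon.2 ((hG j).2.2 _ ⟨i, rfl⟩ hcon.1)
    exact hi ⟨j, hw this⟩

variable [MeasurableSpace Z]

theorem measurableSet_mem_take
    (hRm : ∀ k, MeasurableSet {p : (Fin k → Z) × Z | p.2 ∈ R (List.ofFn p.1)})
    {Ω : Type*} [MeasurableSpace Ω] {k : ℕ} {f : Ω → Fin k → Z} (hf : Measurable f)
    {g : Ω → Z} (hg : Measurable g) (j : Fin k) :
    MeasurableSet {ω | g ω ∈ R ((List.ofFn (f ω)).take j)} := by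
  simp only [← Fin.ofFn_take_eq_take_ofFn j.2.le]
  have hf' : Measurable fun ω => Fin.take (j : ℕ) j.2.le (f ω) :=
    measurable_pi_lambda _ fun i => (measurable_pi_apply _).comp hf
  exact (hf'.prodMk hg) (hRm j)

theorem measurableSet_le_take
    (hlm : ∀ k, MeasurableSet {p : (Fin k → Z) × Z × Z | le (List.ofFn p.1) p.2.1 p.2.2})
    {Ω : Type*} [MeasurableSpace Ω] {k : ℕ} {f : Ω → Fin k → Z} (hf : Measurable f)
    {g h : Ω → Z} (hg : Measurable g) (hh : Measurable h) (j : Fin k) :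
    MeasurableSet {ω | le ((List.ofFn (f ω)).take j) (g ω) (h ω)} := by
  simp only [← Fin.ofFn_take_eq_take_ofFn j.2.le]
  have hf' : Measurable fun ω => Fin.take (j : ℕ) j.2.le (f ω) :=
    measurable_pi_lambda _ fun i => (measurable_pi_apply _).comp hf
  exact (hf'.prodMk (hg.prodMk hh)) (hlm j)

theorem measurableSet_selfGreedy
    (hRm : ∀ k, MeasurableSet {p : (Fin k → Z) × Z | p.2 ∈ R (List.ofFn p.1)})
    (hlm : ∀ k, MeasurableSet {p : (Fin k → Z) × Z × Z | le (List.ofFn p.1) p.2.1 p.2.2})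
    (k : ℕ) : MeasurableSet (selfGreedy R le k) := by
  have e : selfGreedy R le k = ⋂ j : Fin k, {t | t j ∈ R ((List.ofFn t).take j)}ᶜ ∩
      ⋂ i : Fin k, ({t | t i ∈ R ((List.ofFn t).take j)} ∪
        {t | le ((List.ofFn t).take j) (t i) (t j)}) := by
    ext t
    simp only [selfGreedy, Set.mem_ofPred_eq, isGreedy_ofFn, Set.mem_iInter, Set.mem_inter_iff,
      Set.mem_compl_iff, Set.mem_union, Set.forall_mem_range]
    refine forall_congr' fun j => ?_
    simp only [Set.mem_range_self, true_and]
    refine and_congr Iff.rfl (forall_congr' fun i => ?_)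
    tauto
  rw [e]
  refine MeasurableSet.iInter fun j => MeasurableSet.inter ?_ (MeasurableSet.iInter fun i => ?_)
  · exact (measurableSet_mem_take hRm measurable_id (measurable_pi_apply j) j).compl
  · exact (measurableSet_mem_take hRm measurable_id (measurable_pi_apply i) j).union
      (measurableSet_le_take hlm measurable_id (measurable_pi_apply i) (measurable_pi_apply j) j)

theorem measurableSet_unchanging
    (hRm : ∀ k, MeasurableSet {p : (Fin k → Z) × Z | p.2 ∈ R (List.ofFn p.1)})
    (hlm : ∀ k, MeasurableSet {p : (Fin k → Z) × Z × Z | le (List.ofFn p.1) p.2.1 p.2.2})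
    (k : ℕ) : MeasurableSet {p : (Fin k → Z) × Z | p.2 ∈ unchanging R le k p.1} := by
  have e : {p : (Fin k → Z) × Z | p.2 ∈ unchanging R le k p.1} =
      {p | p.2 ∈ R (List.ofFn p.1)} ∩ ⋂ j : Fin k, ({p | p.2 ∈ R ((List.ofFn p.1).take j)} ∪
        {p | le ((List.ofFn p.1).take j) (p.1 j) p.2}ᶜ) := by
    ext p
    simp [unchanging]
  rw [e]
  refine (hRm k).inter ?_
  refine MeasurableSet.iInter fun j => ?_
  exact (measurableSet_mem_take hRm measurable_fst measurable_snd j).union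
    (measurableSet_le_take hlm measurable_fst
      ((measurable_pi_apply j).comp measurable_fst) measurable_snd j).compl

/-- On `m` sample points the events "the picks are those with the indices `σ`" are disjoint, and
their probabilities depend on the size of `σ` only. -/
theorem sum_descFactorial_mul_lintegral_le_one (P : Measure Z) [IsProbabilityMeasure P]
    (hrefl : ∀ S x, le S x x) (hanti : ∀ S y z, le S y z → le S z y → y = z)
    (htot : ∀ S x y, le S x y ∨ le S y x) (hR : ∀ T, ∀ x ∈ T, x ∈ R T)
    (hRm : ∀ k, MeasurableSet {p : (Fin k → Z) × Z | p.2 ∈ R (List.ofFn p.1)})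
    (hlm : ∀ k, MeasurableSet {p : (Fin k → Z) × Z × Z | le (List.ofFn p.1) p.2.1 p.2.2})
    (m : ℕ) :
    ∑ k ∈ Finset.range (m + 1), (m.descFactorial k : ENNReal) *
      ∫⁻ t in selfGreedy R le k, P (unchanging R le k t) ^ (m - k)
        ∂(Measure.pi fun _ : Fin k => P) ≤ 1 := by
  have h := measure_iUnion (μ := Measure.pi fun _ : Fin m => P)
    (embEvent_disjoint hrefl hanti htot hR (m := m))
    (fun s => measurableSet_embEvent s.2 (measurableSet_selfGreedy hRm hlm s.1)
      (measurableSet_unchanging hRm hlm s.1))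
  have h1 := prob_le_one (μ := Measure.pi fun _ : Fin m => P)
    (s := ⋃ s : Σ k : Fin (m + 1), Fin k ↪ Fin m,
      embEvent s.2 (selfGreedy R le s.1) (unchanging R le s.1))
  rw [h, tsum_fintype, Fintype.sum_sigma] at h1
  refine le_of_eq_of_le ?_ h1
  rw [← Fin.sum_univ_eq_sum_range (fun k => (m.descFactorial k : ENNReal) *
      ∫⁻ t in selfGreedy R le k, P (unchanging R le k t) ^ (m - k)
        ∂(Measure.pi fun _ : Fin k => P))]
  refine Finset.sum_congr rfl fun k _ => ?_
  have : ∀ σ : Fin k ↪ Fin m, Measure.pi (fun _ : Fin m => P)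
      (embEvent σ (selfGreedy R le k) (unchanging R le k)) =
      ∫⁻ t in selfGreedy R le k, P (unchanging R le k t) ^ (m - k)
        ∂(Measure.pi fun _ : Fin k => P) := fun σ =>
    measure_embEvent P σ (measurableSet_selfGreedy hRm hlm k) (measurableSet_unchanging hRm hlm k)
  simp only [this, Finset.sum_const, Finset.card_univ, Fintype.card_embedding_eq,
    Fintype.card_fin, nsmul_eq_mul]

/-- The generalization bound for greedy runs, when sample points are almost surely distinct. -/
theorem measure_isGreedyRun_risk_le (P : Measure Z) [IsProbabilityMeasure P]
    (hrefl : ∀ S x, le S x x) (hanti : ∀ S y z, le S y z → le S z y → y = z)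
    (htot : ∀ S x y, le S x y ∨ le S y x) (hR : ∀ T, ∀ x ∈ T, x ∈ R T)
    (hRm : ∀ k, MeasurableSet {p : (Fin k → Z) × Z | p.2 ∈ R (List.ofFn p.1)})
    (hlm : ∀ k, MeasurableSet {p : (Fin k → Z) × Z × Z | le (List.ofFn p.1) p.2.1 p.2.2})
    {M : ℕ} (hinj : ∀ᵐ w ∂(Measure.pi fun _ : Fin M => P), Function.Injective w)
    {δ : ℝ} (h0 : 0 < δ) (h1 : δ < 1) :
    Measure.pi (fun _ : Fin M => P) {w | ∃ T, IsGreedyRun R le (Set.range w) T ∧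
      epsBar T.length δ M < P.real (R T)ᶜ} ≤ ENNReal.ofReal δ := by
  let B : ∀ k, Set (Fin k → Z) := fun k =>
    selfGreedy R le k ∩ {t | epsBar k δ M < P.real (R (List.ofFn t))ᶜ}
  have hRs : ∀ {k} (t : Fin k → Z), MeasurableSet (R (List.ofFn t)) := fun {k} t =>
    measurable_prodMk_left (hRm k)
  have hB : ∀ k, MeasurableSet (B k) := fun k => by
    refine (measurableSet_selfGreedy hRm hlm k).inter (measurableSet_lt measurable_const ?_)
    exact (measurable_measure_prodMk_left (hRm k).compl).ennreal_toReal
  have hA := measurableSet_unchanging hRm hlm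
  -- The run is witnessed by an injection of `k < M` indices: for `k = M` the threshold is `1`.
  have hcover : Measure.pi (fun _ : Fin M => P) {w | ∃ T, IsGreedyRun R le (Set.range w) T ∧
      epsBar T.length δ M < P.real (R T)ᶜ} ≤ Measure.pi (fun _ : Fin M => P)
        (⋃ s : Σ k : Fin M, Fin k ↪ Fin M, embEvent s.2 (B s.1) (unchanging R le s.1)) := by
    refine measure_mono_ae ?_
    filter_upwards [hinj] with w hw
    rintro ⟨T, hT, hlt⟩
    obtain ⟨k, σ, rfl, hσ⟩ := exists_mem_embEvent hanti hR hw hT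
    rw [List.length_ofFn] at hlt
    have hk : k < M := by
      by_contra hcon
      rw [epsBar_of_not_lt δ hcon] at hlt
      exact absurd hlt (not_lt.2 measureReal_le_one)
    exact Set.mem_iUnion.2 ⟨⟨⟨k, hk⟩, σ⟩, ⟨hσ.1, hlt⟩, hσ.2⟩
  -- The weights `δ / M`, summed over `m`, dominate each term.
  have hterm : ∀ k < M, (M.descFactorial k : ENNReal) *
      ∫⁻ t in B k, P (unchanging R le k t) ^ (M - k) ∂(Measure.pi fun _ : Fin k => P) ≤
      ∑ m ∈ Finset.Ico k M, ENNReal.ofReal (δ / M) * ((m.descFactorial k : ENNReal) *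
        ∫⁻ t in selfGreedy R le k, P (unchanging R le k t) ^ (m - k)
          ∂(Measure.pi fun _ : Fin k => P)) := by
    intro k hk
    have hmeas : Measurable fun t => P (unchanging R le k t) :=
      measurable_measure_prodMk_left (hA k)
    calc _ = ∫⁻ t in B k, (M.descFactorial k : ENNReal) * P (unchanging R le k t) ^ (M - k)
            ∂(Measure.pi fun _ : Fin k => P) :=
          (lintegral_const_mul _ (hmeas.pow_const _)).symm
      _ ≤ ∫⁻ t in B k, ∑ m ∈ Finset.Ico k M, ENNReal.ofReal (δ / M) *
            ((m.descFactorial k : ENNReal) * P (unchanging R le k t) ^ (m - k))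
            ∂(Measure.pi fun _ : Fin k => P) := by
          refine setLIntegral_mono' (hB k) fun t ht => ?_
          set q := P.real (unchanging R le k t) with hq
          have hqP : P (unchanging R le k t) = ENNReal.ofReal q := by
            rw [hq, ofReal_measureReal]
          have hle : q ≤ P.real (R (List.ofFn t)) := measureReal_mono fun z hz => hz.1
          have hε : epsBar k δ M < 1 - q := by
            have h2 := ht.2
            rw [Set.mem_ofPred_eq, probReal_compl_eq_one_sub (hRs t)] at h2
            linarith
          have hq0 : 0 ≤ q := measureReal_nonneg
          have key := ENNReal.ofReal_le_ofReal (descFactorial_mul_pow_le hk h0 h1 hq0 hε)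
          rw [hqP]
          rw [Finset.mul_sum, ENNReal.ofReal_sum_of_nonneg (fun _ _ => by positivity)] at key
          rw [ENNReal.ofReal_mul (by positivity), ENNReal.ofReal_natCast,
            ENNReal.ofReal_pow hq0] at key
          refine key.trans_eq (Finset.sum_congr rfl fun m _ => ?_)
          rw [ENNReal.ofReal_mul (by positivity), ENNReal.ofReal_mul (by positivity),
            ENNReal.ofReal_natCast, ENNReal.ofReal_pow hq0]
      _ = ∑ m ∈ Finset.Ico k M, ENNReal.ofReal (δ / M) * ((m.descFactorial k : ENNReal) *
            ∫⁻ t in B k, P (unchanging R le k t) ^ (m - k)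
              ∂(Measure.pi fun _ : Fin k => P)) := by
          rw [lintegral_finsetSum]
          · refine Finset.sum_congr rfl fun m _ => ?_
            rw [lintegral_const_mul _ ((hmeas.pow_const _).const_mul _),
              lintegral_const_mul _ (hmeas.pow_const _)]
          · intro m _
            exact ((hmeas.pow_const _).const_mul _).const_mul _
      _ ≤ _ := by
          gcongr
          exact Set.inter_subset_left
  calc _ ≤ _ := hcover
    _ ≤ ∑ s : Σ k : Fin M, Fin k ↪ Fin M, Measure.pi (fun _ : Fin M => P)
          (embEvent s.2 (B s.1) (unchanging R le s.1)) := measure_iUnion_fintype_le _ _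
    _ = ∑ k ∈ Finset.range M, (M.descFactorial k : ENNReal) *
          ∫⁻ t in B k, P (unchanging R le k t) ^ (M - k) ∂(Measure.pi fun _ : Fin k => P) := by
        rw [Fintype.sum_sigma, ← Fin.sum_univ_eq_sum_range (fun k => (M.descFactorial k : ENNReal) *
          ∫⁻ t in B k, P (unchanging R le k t) ^ (M - k) ∂(Measure.pi fun _ : Fin k => P))]
        refine Finset.sum_congr rfl fun k _ => ?_
        have : ∀ σ : Fin k ↪ Fin M, Measure.pi (fun _ : Fin M => P)
            (embEvent σ (B k) (unchanging R le k)) =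
            ∫⁻ t in B k, P (unchanging R le k t) ^ (M - k) ∂(Measure.pi fun _ : Fin k => P) :=
          fun σ => measure_embEvent P σ (hB k) (hA k)
        simp only [this, Finset.sum_const, Finset.card_univ, Fintype.card_embedding_eq,
          Fintype.card_fin, nsmul_eq_mul]
    _ ≤ ∑ k ∈ Finset.range M, ∑ m ∈ Finset.Ico k M, ENNReal.ofReal (δ / M) *
          ((m.descFactorial k : ENNReal) *
          ∫⁻ t in selfGreedy R le k, P (unchanging R le k t) ^ (m - k)
            ∂(Measure.pi fun _ : Fin k => P)) :=
        Finset.sum_le_sum fun k hk => hterm k (Finset.mem_range.1 hk)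
    _ = ∑ m ∈ Finset.range M, ENNReal.ofReal (δ / M) * ∑ k ∈ Finset.range (m + 1),
          (m.descFactorial k : ENNReal) *
          ∫⁻ t in selfGreedy R le k, P (unchanging R le k t) ^ (m - k)
            ∂(Measure.pi fun _ : Fin k => P) := by
        simp only [Finset.mul_sum]
        refine Finset.sum_comm' fun k m => ?_
        simp only [Finset.mem_range, Finset.mem_Ico]
        omega
    _ ≤ ∑ m ∈ Finset.range M, ENNReal.ofReal (δ / M) * 1 := by
        gcongr
        exact sum_descFactorial_mul_lintegral_le_one P hrefl hanti htot hR hRm hlm _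
    _ ≤ ENNReal.ofReal δ := by
        rw [mul_one, Finset.sum_const, Finset.card_range, nsmul_eq_mul,
          ← ENNReal.ofReal_natCast, ← ENNReal.ofReal_mul (by positivity)]
        refine ENNReal.ofReal_le_ofReal ?_
        rcases Nat.eq_zero_or_pos M with rfl | hM
        · simpa using h0.le
        · have : (M : ℝ) ≠ 0 := by positivity
          rw [mul_div_cancel₀ _ this]

end Bound

/-! ### Atoms: uniform labels and measurability of the run -/

section Randomization

variable {Z : Type*}

/-- A total order on labelled points `(z, u)` that refines `le` by comparing labels. -/
def labelledLE (le : List Z → Z → Z → Prop) (T : List (Z × unitInterval))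
    (a b : Z × unitInterval) : Prop :=
  le (T.map Prod.fst) a.1 b.1 ∧ (le (T.map Prod.fst) b.1 a.1 → a.2 ≤ b.2)

/-- The region `R` for labelled points, which ignores the labels. -/
def labelledRegion (R : List Z → Set Z) (T : List (Z × unitInterval)) : Set (Z × unitInterval) :=
  Prod.fst ⁻¹' R (T.map Prod.fst)

variable {R : List Z → Set Z} {le : List Z → Z → Z → Prop}

theorem IsGreedyRun.map_fst {V : Set (Z × unitInterval)} {T : List (Z × unitInterval)}
    (hT : IsGreedyRun (labelledRegion R) (labelledLE le) V T) :
    IsGreedyRun R le (Prod.fst '' V) (T.map Prod.fst) := by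
  refine ⟨fun S x r e => ?_, ?_⟩
  · obtain ⟨S', r', rfl, rfl, e2⟩ := List.map_eq_append_iff.1 e
    obtain ⟨x', r'', rfl, rfl, rfl⟩ := List.map_eq_cons_iff.1 e2
    obtain ⟨h1, h2, h3⟩ := hT.1 S' x' r'' rfl
    refine ⟨⟨x', h1, rfl⟩, h2, ?_⟩
    rintro _ ⟨z, hz, rfl⟩ hzR
    exact (h3 z hz hzR).1
  · rintro _ ⟨z, hz, rfl⟩
    exact hT.2 hz

theorem exists_isGreedyRun_range (hrefl : ∀ S x, le S x x)
    (htrans : ∀ S x y z, le S x y → le S y z → le S x z)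
    (htot : ∀ S x y, le S x y ∨ le S y x) (hR : ∀ T, ∀ x ∈ T, x ∈ R T) {M : ℕ} (w : Fin M → Z) :
    ∃ T, IsGreedyRun R le (Set.range w) T := by
  obtain ⟨T, hT⟩ := exists_isGreedyRun hrefl htrans htot hR (List.ofFn w)
  have e : {z | z ∈ List.ofFn w} = Set.range w := by
    ext z
    exact List.mem_ofFn
  exact ⟨T, e ▸ hT⟩

variable [MeasurableSpace Z]

theorem ae_injective_snd (P : Measure Z) [IsProbabilityMeasure P] (M : ℕ) :
    ∀ᵐ w ∂(Measure.pi fun _ : Fin M => P.prod (volume : Measure unitInterval)),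
      Function.Injective fun i => (w i).2 := by
  set Q := P.prod (volume : Measure unitInterval) with hQ
  have hpair : ∀ i j : Fin M, i ≠ j → ∀ᵐ w ∂(Measure.pi fun _ : Fin M => Q),
      (w i).2 ≠ (w j).2 := by
    intro i j hij
    have hind : iIndepFun (fun (i : Fin M) (w : Fin M → Z × unitInterval) => (w i).2)
        (Measure.pi fun _ : Fin M => Q) :=
      iIndepFun_pi (X := fun _ : Fin M => (Prod.snd : Z × unitInterval → unitInterval))
        fun _ => measurable_snd.aemeasurable
    have hmp : ∀ i : Fin M, MeasurePreserving (fun w : Fin M → Z × unitInterval => (w i).2)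
        (Measure.pi fun _ : Fin M => Q) volume := fun i =>
      measurePreserving_snd.comp (measurePreserving_eval (fun _ : Fin M => Q) i)
    have hmap := (indepFun_iff_map_prod_eq_prod_map_map (hmp i).measurable.aemeasurable
      (hmp j).measurable.aemeasurable).1 (hind.indepFun hij)
    rw [(hmp i).map_eq, (hmp j).map_eq] at hmap
    have hd : MeasurableSet {p : unitInterval × unitInterval | p.1 = p.2} :=
      measurableSet_eq_fun measurable_fst measurable_snd
    have h0 : ((volume : Measure unitInterval).prod (volume : Measure unitInterval))
        {p | p.1 = p.2} = 0 := by
      rw [Measure.measure_prod_null hd]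
      refine Filter.Eventually.of_forall fun x => ?_
      have : Prod.mk x ⁻¹' {p : unitInterval × unitInterval | p.1 = p.2} = {x} := by
        ext y
        exact eq_comm
      simp only [this, Pi.zero_apply]
      exact measure_singleton x
    rw [← hmap, Measure.map_apply ((hmp i).measurable.prodMk (hmp j).measurable) hd] at h0
    exact measure_eq_zero_iff_ae_notMem.1 h0
  have hall : ∀ᵐ w ∂(Measure.pi fun _ : Fin M => Q), ∀ i j, i ≠ j → (w i).2 ≠ (w j).2 := by
    simp only [ae_all_iff]
    exact hpair
  filter_upwards [hall] with w hw i j hij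
  by_contra hne
  exact hw i j hne hij

/-- The generalization bound for greedy runs. Sample points receive independent uniform labels,
which break ties between equal points; labels change neither the run nor its risk. -/
theorem measure_isGreedyRun_risk_le_of_measurableSet (P : Measure Z) [IsProbabilityMeasure P]
    (hrefl : ∀ S x, le S x x) (hanti : ∀ S y z, le S y z → le S z y → y = z)
    (htrans : ∀ S x y z, le S x y → le S y z → le S x z)
    (htot : ∀ S x y, le S x y ∨ le S y x) (hR : ∀ T, ∀ x ∈ T, x ∈ R T)
    (hRm : ∀ k, MeasurableSet {p : (Fin k → Z) × Z | p.2 ∈ R (List.ofFn p.1)})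
    (hlm : ∀ k, MeasurableSet {p : (Fin k → Z) × Z × Z | le (List.ofFn p.1) p.2.1 p.2.2})
    {M : ℕ} {δ : ℝ} (h0 : 0 < δ) (h1 : δ < 1)
    (hbad : MeasurableSet {w : Fin M → Z | ∃ T, IsGreedyRun R le (Set.range w) T ∧
      epsBar T.length δ M < P.real (R T)ᶜ}) :
    Measure.pi (fun _ : Fin M => P) {w | ∃ T, IsGreedyRun R le (Set.range w) T ∧
      epsBar T.length δ M < P.real (R T)ᶜ} ≤ ENNReal.ofReal δ := by
  set Q := P.prod (volume : Measure unitInterval) with hQ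
  have hfst : MeasurePreserving (Prod.fst : Z × unitInterval → Z) Q P := measurePreserving_fst
  have hmp := measurePreserving_pi (fun _ : Fin M => Q) (fun _ : Fin M => P) fun _ => hfst
  have hRs : ∀ T, MeasurableSet (R T) := fun T => by
    have e : R T = Prod.mk T.get ⁻¹' {p : (Fin T.length → Z) × Z | p.2 ∈ R (List.ofFn p.1)} := by
      ext z
      simp only [Set.mem_preimage, Set.mem_ofPred_eq, List.ofFn_get]
    rw [e]
    exact measurable_prodMk_left (hRm T.length)
  have hrefl' : ∀ S x, labelledLE le S x x := fun S x => ⟨hrefl _ _, fun _ => le_rfl⟩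
  have hanti' : ∀ S y z, labelledLE le S y z → labelledLE le S z y → y = z := fun S y z h h' =>
    Prod.ext (hanti _ _ _ h.1 h'.1) (le_antisymm (h.2 h'.1) (h'.2 h.1))
  have htrans' : ∀ S x y z, labelledLE le S x y → labelledLE le S y z → labelledLE le S x z :=
    fun S x y z h h' => ⟨htrans _ _ _ _ h.1 h'.1, fun hzx =>
      (h.2 (htrans _ _ _ _ h'.1 hzx)).trans (h'.2 (htrans _ _ _ _ hzx h.1))⟩
  have htot' : ∀ S x y, labelledLE le S x y ∨ labelledLE le S y x := by
    intro S x y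
    by_cases hxy : le (S.map Prod.fst) x.1 y.1
    · by_cases hyx : le (S.map Prod.fst) y.1 x.1
      · exact (le_total x.2 y.2).imp (fun h => ⟨hxy, fun _ => h⟩) fun h => ⟨hyx, fun _ => h⟩
      · exact Or.inl ⟨hxy, fun h => absurd h hyx⟩
    · exact Or.inr ⟨(htot _ _ _).resolve_left hxy, fun h => absurd h hxy⟩
  have hR' : ∀ T, ∀ x ∈ T, x ∈ labelledRegion R T := fun T x hx =>
    hR _ _ (List.mem_map_of_mem hx)
  have hmapm : ∀ k, Measurable fun (t : Fin k → Z × unitInterval) => Prod.fst ∘ t := fun k =>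
    measurable_pi_lambda _ fun i => measurable_fst.comp (measurable_pi_apply i)
  have hRm' : ∀ k, MeasurableSet {p : (Fin k → Z × unitInterval) × (Z × unitInterval) |
      p.2 ∈ labelledRegion R (List.ofFn p.1)} := by
    intro k
    simp only [labelledRegion, List.map_ofFn]
    exact (((hmapm k).comp measurable_fst).prodMk (measurable_fst.comp measurable_snd)) (hRm k)
  have hlm' : ∀ k, MeasurableSet
      {p : (Fin k → Z × unitInterval) × (Z × unitInterval) × (Z × unitInterval) |
        labelledLE le (List.ofFn p.1) p.2.1 p.2.2} := by
    intro k
    simp only [labelledLE, List.map_ofFn]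
    have hab : MeasurableSet
        {p : (Fin k → Z × unitInterval) × (Z × unitInterval) × (Z × unitInterval) |
          le (List.ofFn (Prod.fst ∘ p.1)) p.2.1.1 p.2.2.1} :=
      (((hmapm k).comp measurable_fst).prodMk ((measurable_fst.comp
        (measurable_fst.comp measurable_snd)).prodMk (measurable_fst.comp
        (measurable_snd.comp measurable_snd)))) (hlm k)
    have hba : MeasurableSet
        {p : (Fin k → Z × unitInterval) × (Z × unitInterval) × (Z × unitInterval) |
          le (List.ofFn (Prod.fst ∘ p.1)) p.2.2.1 p.2.1.1} :=
      (((hmapm k).comp measurable_fst).prodMk ((measurable_fst.comp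
        (measurable_snd.comp measurable_snd)).prodMk (measurable_fst.comp
        (measurable_fst.comp measurable_snd)))) (hlm k)
    have hu : MeasurableSet
        {p : (Fin k → Z × unitInterval) × (Z × unitInterval) × (Z × unitInterval) |
          p.2.1.2 ≤ p.2.2.2} :=
      measurableSet_le (measurable_snd.comp (measurable_fst.comp measurable_snd))
        (measurable_snd.comp (measurable_snd.comp measurable_snd))
    simp only [imp_iff_not_or]
    exact hab.inter (hba.compl.union hu)
  have hinj : ∀ᵐ w ∂(Measure.pi fun _ : Fin M => Q), Function.Injective w := by
    filter_upwards [ae_injective_snd P M] with w hw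
    exact Function.Injective.of_comp (f := Prod.snd) hw
  rw [← hmp.measure_preimage hbad.nullMeasurableSet]
  refine (measure_mono ?_).trans
    (measure_isGreedyRun_risk_le Q hrefl' hanti' htot' hR' hRm' hlm' hinj h0 h1)
  rintro w ⟨T, hT, hlt⟩
  obtain ⟨T', hT'⟩ := exists_isGreedyRun_range hrefl' htrans' htot' hR' w
  refine ⟨T', hT', ?_⟩
  have hT'' := hT'.map_fst
  rw [← Set.range_comp] at hT''
  obtain rfl := hT.unique hanti hT''
  rw [List.length_map] at hlt
  rw [labelledRegion, ← Set.preimage_compl, Measure.real,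
    hfst.measure_preimage (hRs _).compl.nullMeasurableSet]
  exact hlt

end Randomization

/-- Joint measurability, in a parameter `x` and the sample `w`, of the event that a greedy run on
`w` has risk above its threshold. -/
theorem measurableSet_isGreedyRun_risk {X Z : Type*} [MeasurableSpace X] [MeasurableSpace Z]
    {R : X → List Z → Set Z} {le : X → List Z → Z → Z → Prop}
    (P : Measure Z) [IsProbabilityMeasure P]
    (hRm : ∀ k, MeasurableSet {p : (X × (Fin k → Z)) × Z | p.2 ∈ R p.1.1 (List.ofFn p.1.2)})
    (hlm : ∀ k, MeasurableSet
      {p : (X × (Fin k → Z)) × Z × Z | le p.1.1 (List.ofFn p.1.2) p.2.1 p.2.2})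
    (M : ℕ) (δ : ℝ) :
    MeasurableSet {p : X × (Fin M → Z) | ∃ T, IsGreedyRun (R p.1) (le p.1) (Set.range p.2) T ∧
      epsBar T.length δ M < P.real (R p.1 T)ᶜ} := by
  have e : {p : X × (Fin M → Z) | ∃ T, IsGreedyRun (R p.1) (le p.1) (Set.range p.2) T ∧
      epsBar T.length δ M < P.real (R p.1 T)ᶜ} =
      ⋃ k : ℕ, ⋃ s : Fin k → Fin M,
        ((⋂ j : Fin k, ({p | p.2 (s j) ∈ R p.1 ((List.ofFn (p.2 ∘ s)).take j)}ᶜ ∩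
          ⋂ i : Fin M, ({p | p.2 i ∈ R p.1 ((List.ofFn (p.2 ∘ s)).take j)} ∪
            {p | le p.1 ((List.ofFn (p.2 ∘ s)).take j) (p.2 i) (p.2 (s j))}))) ∩
        ⋂ i : Fin M, {p | p.2 i ∈ R p.1 (List.ofFn (p.2 ∘ s))}) ∩
        {p | epsBar k δ M < P.real (R p.1 (List.ofFn (p.2 ∘ s)))ᶜ} := by
    ext p
    simp only [Set.mem_iUnion, Set.mem_inter_iff, Set.mem_iInter, Set.mem_compl_iff,
      Set.mem_union, Set.mem_ofPred_eq]
    have key : ∀ (k : ℕ) (s : Fin k → Fin M),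
        IsGreedyRun (R p.1) (le p.1) (Set.range p.2) (List.ofFn (p.2 ∘ s)) ↔
        ((∀ j : Fin k, p.2 (s j) ∉ R p.1 ((List.ofFn (p.2 ∘ s)).take j) ∧
          ∀ i : Fin M, p.2 i ∈ R p.1 ((List.ofFn (p.2 ∘ s)).take j) ∨
            le p.1 ((List.ofFn (p.2 ∘ s)).take j) (p.2 i) (p.2 (s j))) ∧
        ∀ i : Fin M, p.2 i ∈ R p.1 (List.ofFn (p.2 ∘ s))) := by
      intro k s
      rw [IsGreedyRun, isGreedy_ofFn, Set.range_subset_iff]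
      refine and_congr (forall_congr' fun j => ?_) Iff.rfl
      simp only [Set.forall_mem_range, Function.comp_apply, Set.mem_range_self, true_and,
        or_iff_not_imp_left]
    constructor
    · rintro ⟨T, hT, hlt⟩
      have hex : ∀ j : Fin T.length, ∃ i, p.2 i = T.get j := fun j => hT.1.mem (T.get_mem j)
      choose s hs using hex
      have hsT : List.ofFn (p.2 ∘ s) = T := by
        rw [show p.2 ∘ s = T.get from funext hs, List.ofFn_get]
      refine ⟨T.length, s, (key _ s).1 (by rwa [hsT]), by rwa [hsT]⟩
    · rintro ⟨k, s, h, hlt⟩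
      exact ⟨_, (key k s).2 h, by rwa [List.length_ofFn]⟩
  have htake : ∀ {k : ℕ} (s : Fin k → Fin M) (j : Fin k), Measurable fun p : X × (Fin M → Z) =>
      (p.1, Fin.take (j : ℕ) j.2.le (p.2 ∘ s)) := fun s j =>
    measurable_fst.prodMk (measurable_pi_lambda _ fun i =>
      (measurable_pi_apply _).comp measurable_snd)
  have hsel : ∀ {k : ℕ} (s : Fin k → Fin M), Measurable fun p : X × (Fin M → Z) =>
      (p.1, p.2 ∘ s) := fun s =>
    measurable_fst.prodMk (measurable_pi_lambda _ fun i =>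
      (measurable_pi_apply _).comp measurable_snd)
  have hev : ∀ i : Fin M, Measurable fun p : X × (Fin M → Z) => p.2 i := fun i =>
    (measurable_pi_apply i).comp measurable_snd
  rw [e]
  simp only [← Fin.ofFn_take_eq_take_ofFn (Fin.is_lt _).le]
  refine MeasurableSet.iUnion fun k => MeasurableSet.iUnion fun s => ?_
  refine ((MeasurableSet.iInter fun j => ?_).inter (MeasurableSet.iInter fun i => ?_)).inter ?_
  · refine MeasurableSet.inter ?_ (MeasurableSet.iInter fun i => ?_)
    · exact (((htake s j).prodMk (hev (s j))) (hRm j)).compl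
    · exact (((htake s j).prodMk (hev i)) (hRm j)).union
        (((htake s j).prodMk ((hev i).prodMk (hev (s j)))) (hlm j))
  · exact ((hsel s).prodMk (hev i)) (hRm k)
  · refine measurableSet_lt measurable_const ?_
    exact ((measurable_measure_prodMk_left (hRm k).compl).ennreal_toReal).comp (hsel s)

/-! ### The Christoffel synthesis -/

section Christoffel

variable {n d : ℕ}

theorem coe_le_maximum_iff {α : Type*} [LinearOrder α] {a : α} {l : List α} :
    (a : WithBot α) ≤ l.maximum ↔ ∃ b ∈ l, a ≤ b := by
  constructor
  · intro h
    cases hm : l.maximum with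
    | bot =>
      rw [hm] at h
      exact absurd h (by simp)
    | coe b =>
      rw [hm] at h
      exact ⟨b, List.maximum_mem hm, WithBot.coe_le_coe.1 h⟩
  · rintro ⟨b, hb, hab⟩
    exact (WithBot.coe_le_coe.2 hab).trans (List.le_maximum_of_mem' hb)

theorem mem_christoffelSynth_iff
    {inv : Matrix (MonoIdx n d) (MonoIdx n d) ℝ → Matrix (MonoIdx n d) (MonoIdx n d) ℝ}
    {T : List (Fin n → ℝ)} {x : Fin n → ℝ} :
    inReachSet (christoffelSynth inv T) x ↔
      ∃ y ∈ T, invChristoffel inv T x ≤ invChristoffel inv T y := by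
  change ((invChristoffel inv T x : ℝ) : WithBot ℝ) ≤ (T.map (invChristoffel inv T)).maximum ↔ _
  simp only [coe_le_maximum_iff, List.mem_map, exists_exists_and_eq_and]

theorem measurable_monoVec (m : MonoIdx n d) : Measurable fun x : Fin n → ℝ => monoVec d x m := by
  unfold monoVec
  fun_prop

theorem measurable_invChristoffel
    {inv : Matrix (MonoIdx n d) (MonoIdx n d) ℝ → Matrix (MonoIdx n d) (MonoIdx n d) ℝ}
    (hinv_meas : ∀ i j, Measurable fun M : MonoIdx n d → MonoIdx n d → ℝ =>
      inv (Matrix.of M) i j) (m : ℕ) :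
    Measurable fun p : (Fin m → Fin n → ℝ) × (Fin n → ℝ) =>
      invChristoffel inv (List.ofFn p.1) p.2 := by
  have hM : Measurable fun p : (Fin m → Fin n → ℝ) × (Fin n → ℝ) =>
      (fun i j => momentMatrix d (List.ofFn p.1) i j : MonoIdx n d → MonoIdx n d → ℝ) := by
    refine measurable_pi_lambda _ fun i => measurable_pi_lambda _ fun j => ?_
    have e : ∀ p : (Fin m → Fin n → ℝ) × (Fin n → ℝ), momentMatrix d (List.ofFn p.1) i j =
        1 / (m : ℝ) * ∑ l, monoVec d (p.1 l) i * monoVec d (p.1 l) j := by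
      intro p
      simp [momentMatrix, List.map_ofFn, List.sum_ofFn, Matrix.sum_apply, Matrix.vecMulVec_apply]
    simp only [e]
    refine (Finset.measurable_sum _ fun l _ => ?_).const_mul _
    have hl : Measurable fun p : (Fin m → Fin n → ℝ) × (Fin n → ℝ) => p.1 l :=
      (measurable_pi_apply l).comp measurable_fst
    exact ((measurable_monoVec i).comp hl).mul ((measurable_monoVec j).comp hl)
  have hv : ∀ i, Measurable fun p : (Fin m → Fin n → ℝ) × (Fin n → ℝ) =>
      monoVec d p.2 i := fun i => (measurable_monoVec i).comp measurable_snd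
  simp only [invChristoffel, dotProduct, Matrix.mulVec]
  refine Finset.measurable_sum _ fun i _ => (hv i).mul (Finset.measurable_sum _ fun j _ => ?_)
  exact ((hinv_meas i j).comp hM).mul (hv j)

theorem Measurable.invChristoffel_ofFn
    {inv : Matrix (MonoIdx n d) (MonoIdx n d) ℝ → Matrix (MonoIdx n d) (MonoIdx n d) ℝ}
    (hinv_meas : ∀ i j, Measurable fun M : MonoIdx n d → MonoIdx n d → ℝ =>
      inv (Matrix.of M) i j) {Ω : Type*} [MeasurableSpace Ω] {m : ℕ}
    {f : Ω → Fin m → Fin n → ℝ} {g : Ω → Fin n → ℝ} (hf : Measurable f) (hg : Measurable g) :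
    Measurable fun ω => invChristoffel inv (List.ofFn (f ω)) (g ω) := by
  have h := Measurable.comp (measurable_invChristoffel hinv_meas m) (hf.prodMk hg)
  exact h

/-- The decision of P2L for reachability after the picks `T`, as a function of the initial
points `x`. -/
noncomputable def reachDecisionAfter
    (inv : Matrix (MonoIdx n d) (MonoIdx n d) ℝ → Matrix (MonoIdx n d) (MonoIdx n d) ℝ)
    (keep : Bool) {Ni : ℕ} (x : Fin Ni → Fin n → ℝ) : List (Fin n → ℝ) → ReachDecision n :=
  decisionAfter (fun T => christoffelSynth inv (if keep then List.ofFn x ++ T else T))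
    (christoffelSynth inv (List.ofFn x))

/-- After `k` picks the decision is synthesised from a list of fixed length, which depends
measurably on the data. -/
theorem exists_reachDecisionAfter_eq
    (inv : Matrix (MonoIdx n d) (MonoIdx n d) ℝ → Matrix (MonoIdx n d) (MonoIdx n d) ℝ)
    (keep : Bool) (Ni k : ℕ) :
    ∃ (m : ℕ) (g : (Fin Ni → Fin n → ℝ) × (Fin k → Fin n → ℝ) → Fin m → Fin n → ℝ),
      Measurable g ∧ ∀ p, reachDecisionAfter inv keep p.1 (List.ofFn p.2) =
        christoffelSynth inv (List.ofFn (g p)) := by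
  cases k with
  | zero => exact ⟨Ni, Prod.fst, measurable_fst, fun p => by simp [reachDecisionAfter,
      decisionAfter]⟩
  | succ k =>
    cases keep with
    | false =>
      exact ⟨k + 1, Prod.snd, measurable_snd, fun p => by
        rw [reachDecisionAfter, decisionAfter_of_ne_nil _ _ (by simp)]
        simp⟩
    | true =>
      refine ⟨Ni + (k + 1), fun p => Fin.append p.1 p.2, ?_, fun p => ?_⟩
      · refine measurable_pi_lambda _ fun i => ?_
        induction i using Fin.addCases with
        | left i =>
          simp only [Fin.append_left]
          exact (measurable_pi_apply i).comp measurable_fst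
        | right i =>
          simp only [Fin.append_right]
          exact (measurable_pi_apply i).comp measurable_snd
      · rw [reachDecisionAfter, decisionAfter_of_ne_nil _ _ (by simp)]
        simp only [if_true, List.ofFn_fin_append]

theorem inReachSet_christoffelSynth
    (inv : Matrix (MonoIdx n d) (MonoIdx n d) ℝ → Matrix (MonoIdx n d) (MonoIdx n d) ℝ)
    (keep : Bool) (D T : List (Fin n → ℝ)) : ∀ z ∈ T,
      inReachSet (christoffelSynth inv (if keep then D ++ T else T)) z := by
  intro z hz
  refine mem_christoffelSynth_iff.2 ⟨z, ?_, le_rfl⟩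
  split_ifs
  · exact List.mem_append_right _ hz
  · exact hz

theorem measurableSet_inReachSet
    {inv : Matrix (MonoIdx n d) (MonoIdx n d) ℝ → Matrix (MonoIdx n d) (MonoIdx n d) ℝ}
    (hinv_meas : ∀ i j, Measurable fun M : MonoIdx n d → MonoIdx n d → ℝ =>
      inv (Matrix.of M) i j) (keep : Bool) (Ni k : ℕ) :
    MeasurableSet {p : ((Fin Ni → Fin n → ℝ) × (Fin k → Fin n → ℝ)) × (Fin n → ℝ) |
      inReachSet (reachDecisionAfter inv keep p.1.1 (List.ofFn p.1.2)) p.2} := by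
  obtain ⟨m, g, hg, h⟩ := exists_reachDecisionAfter_eq inv keep Ni k
  have hg' : Measurable
      fun p : ((Fin Ni → Fin n → ℝ) × (Fin k → Fin n → ℝ)) × (Fin n → ℝ) => g p.1 :=
    hg.comp measurable_fst
  simp only [h, mem_christoffelSynth_iff, List.mem_ofFn, exists_exists_eq_and, Set.ofPred_exists]
  refine MeasurableSet.iUnion fun i => measurableSet_le ?_ ?_
  · exact hg'.invChristoffel_ofFn hinv_meas measurable_snd
  · exact hg'.invChristoffel_ofFn hinv_meas ((measurable_pi_apply i).comp hg')

theorem measurableSet_dissatLE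
    {inv : Matrix (MonoIdx n d) (MonoIdx n d) ℝ → Matrix (MonoIdx n d) (MonoIdx n d) ℝ}
    (hinv_meas : ∀ i j, Measurable fun M : MonoIdx n d → MonoIdx n d → ℝ =>
      inv (Matrix.of M) i j)
    {pref : (Fin n → ℝ) → (Fin n → ℝ) → Prop}
    (hpref_meas : MeasurableSet {p : (Fin n → ℝ) × (Fin n → ℝ) | pref p.1 p.2})
    (keep : Bool) (Ni k : ℕ) :
    MeasurableSet {p : ((Fin Ni → Fin n → ℝ) × (Fin k → Fin n → ℝ)) × (Fin n → ℝ) × (Fin n → ℝ) |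
      dissatLE pref (reachDecisionAfter inv keep p.1.1 (List.ofFn p.1.2)) p.2.1 p.2.2} := by
  obtain ⟨m, g, hg, h⟩ := exists_reachDecisionAfter_eq inv keep Ni k
  have hg' : Measurable
      fun p : ((Fin Ni → Fin n → ℝ) × (Fin k → Fin n → ℝ)) × (Fin n → ℝ) × (Fin n → ℝ) =>
        g p.1 :=
    hg.comp measurable_fst
  have hy : Measurable
      fun p : ((Fin Ni → Fin n → ℝ) × (Fin k → Fin n → ℝ)) × (Fin n → ℝ) × (Fin n → ℝ) =>
        invChristoffel inv (List.ofFn (g p.1)) p.2.1 :=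
    hg'.invChristoffel_ofFn hinv_meas (measurable_fst.comp measurable_snd)
  have hz : Measurable
      fun p : ((Fin Ni → Fin n → ℝ) × (Fin k → Fin n → ℝ)) × (Fin n → ℝ) × (Fin n → ℝ) =>
        invChristoffel inv (List.ofFn (g p.1)) p.2.2 :=
    hg'.invChristoffel_ofFn hinv_meas (measurable_snd.comp measurable_snd)
  simp only [h, dissatLE]
  exact (measurableSet_lt hy hz).union
    ((measurableSet_eq_fun hy hz).inter (measurable_snd hpref_meas))

end Christoffel

section DissatLE

variable {n : ℕ} {pref : (Fin n → ℝ) → (Fin n → ℝ) → Prop} (h : ReachDecision n)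

theorem dissatLE_trans (hpref_trans : ∀ x y w, pref x y → pref y w → pref x w)
    (x y z : Fin n → ℝ) (hxy : dissatLE pref h x y) (hyz : dissatLE pref h y z) :
    dissatLE pref h x z := by
  rcases hxy with hxy | ⟨hxy, pxy⟩ <;> rcases hyz with hyz | ⟨hyz, pyz⟩
  · exact Or.inl (hxy.trans hyz)
  · exact Or.inl (hxy.trans_eq hyz)
  · exact Or.inl (hxy.trans_lt hyz)
  · exact Or.inr ⟨hxy.trans hyz, hpref_trans _ _ _ pxy pyz⟩

theorem dissatLE_total (hpref_total : ∀ x y, pref x y ∨ pref y x) (x y : Fin n → ℝ) :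
    dissatLE pref h x y ∨ dissatLE pref h y x := by
  rcases lt_trichotomy (h.kappaInv x) (h.kappaInv y) with hlt | heq | hgt
  · exact Or.inl (Or.inl hlt)
  · exact (hpref_total x y).imp (fun p => Or.inr ⟨heq, p⟩) fun p => Or.inr ⟨heq.symm, p⟩
  · exact Or.inr (Or.inl hgt)

theorem dissatLE_antisymm (hpref_antisymm : ∀ x y, pref x y → pref y x → x = y)
    (x y : Fin n → ℝ) (hxy : dissatLE pref h x y) (hyx : dissatLE pref h y x) : x = y := by
  rcases hxy with hxy | ⟨hxy, pxy⟩ <;> rcases hyx with hyx | ⟨hyx, pyx⟩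
  · exact absurd hyx hxy.not_gt
  · exact absurd hyx hxy.ne'
  · exact absurd hxy hyx.ne'
  · exact hpref_antisymm _ _ pxy pyx

end DissatLE

/-! ### The probabilistic guarantee -/

theorem corollary1 {Ω : Type*} [MeasurableSpace Ω] (μ : Measure Ω) [IsProbabilityMeasure μ]
    (n d N Ni : ℕ) (hNi : 1 ≤ Ni) (hNiN : Ni ≤ N)
    -- the distribution of the final state, and the i.i.d. dataset
    (Pz : Measure (Fin n → ℝ)) [IsProbabilityMeasure Pz]
    (z : Fin N → Ω → (Fin n → ℝ)) (hz : ∀ i, Measurable (z i))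
    (hlaw : ∀ i, Measure.map (z i) μ = Pz) (hindep : iIndepFun z μ)
    -- matrix inversion, with any measurable convention for singular matrices
    (inv : Matrix (MonoIdx n d) (MonoIdx n d) ℝ → Matrix (MonoIdx n d) (MonoIdx n d) ℝ)
    (hinv : ∀ M, IsUnit M → inv M = M⁻¹)
    (hinv_meas : ∀ i j, Measurable fun M : MonoIdx n d → MonoIdx n d → ℝ =>
      inv (Matrix.of M) i j)
    -- the tie-breaking preference, a measurable total order
    (pref : (Fin n → ℝ) → (Fin n → ℝ) → Prop)
    (hpref_refl : ∀ x, pref x x)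
    (hpref_antisymm : ∀ x y, pref x y → pref y x → x = y)
    (hpref_trans : ∀ x y w, pref x y → pref y w → pref x w)
    (hpref_total : ∀ x y, pref x y ∨ pref y x)
    (hpref_meas : MeasurableSet {p : (Fin n → ℝ) × (Fin n → ℝ) | pref p.1 p.2})
    (keep : Bool) (δ : ℝ) (hδ0 : 0 < δ) (hδ1 : δ < 1) :
    1 - δ ≤ μ.real {ω |
      Pz.real {x | x ∉ (p2lReach inv pref keep Ni (List.ofFn fun i => z i ω)).1.S} ≤
        epsBar (p2lReach inv pref keep Ni (List.ofFn fun i => z i ω)).2.length δ (N - Ni)} := by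
  obtain ⟨M, rfl⟩ := Nat.exists_eq_add_of_le hNiN
  rw [Nat.add_sub_cancel_left]
  let R : (Fin Ni → Fin n → ℝ) → List (Fin n → ℝ) → Set (Fin n → ℝ) := fun x T =>
    {y | inReachSet (reachDecisionAfter inv keep x T) y}
  let le : (Fin Ni → Fin n → ℝ) → List (Fin n → ℝ) → (Fin n → ℝ) → (Fin n → ℝ) → Prop :=
    fun x T => dissatLE pref (reachDecisionAfter inv keep x T)
  have hrefl : ∀ (h : ReachDecision n) y, dissatLE pref h y y := fun h y =>
    Or.inr ⟨rfl, hpref_refl y⟩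
  have hR : ∀ x T, ∀ y ∈ T, y ∈ R x T := by
    intro x T y hy
    have h := inReachSet_christoffelSynth inv keep (List.ofFn x) T y hy
    change inReachSet (reachDecisionAfter inv keep x T) y
    rwa [reachDecisionAfter, decisionAfter_of_ne_nil _ _ (List.ne_nil_of_mem hy)]
  let bad : Set ((Fin Ni → Fin n → ℝ) × (Fin M → Fin n → ℝ)) :=
    {p | ∃ T, IsGreedyRun (R p.1) (le p.1) (Set.range p.2) T ∧
      epsBar T.length δ M < Pz.real (R p.1 T)ᶜ}
  have hbad : MeasurableSet bad := measurableSet_isGreedyRun_risk Pz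
    (measurableSet_inReachSet hinv_meas keep Ni)
    (measurableSet_dissatLE hinv_meas hpref_meas keep Ni) M δ
  -- Conditionally on the initial points the bound holds; then integrate over them.
  have hbad_le : ((Measure.pi fun _ : Fin Ni => Pz).prod (Measure.pi fun _ : Fin M => Pz)) bad ≤
      ENNReal.ofReal δ := by
    rw [Measure.prod_apply hbad]
    calc _ ≤ ∫⁻ _, ENNReal.ofReal δ ∂(Measure.pi fun _ : Fin Ni => Pz) := by
          refine lintegral_mono fun x => ?_
          refine measure_isGreedyRun_risk_le_of_measurableSet (R := R x) (le := le x) Pz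
            (fun S => hrefl _) (fun S => dissatLE_antisymm _ hpref_antisymm)
            (fun S => dissatLE_trans _ hpref_trans) (fun S => dissatLE_total _ hpref_total)
            (hR x) (fun k => ?_) (fun k => ?_) hδ0 hδ1 (measurable_prodMk_left hbad)
          · exact ((measurable_prodMk_left.comp measurable_fst).prodMk measurable_snd)
              (measurableSet_inReachSet hinv_meas keep Ni k)
          · exact ((measurable_prodMk_left.comp measurable_fst).prodMk measurable_snd)
              (measurableSet_dissatLE hinv_meas hpref_meas keep Ni k)
      _ = ENNReal.ofReal δ := by simp
  have hpi : MeasurePreserving (fun ω i => z i ω) μ (Measure.pi fun _ : Fin (Ni + M) => Pz) := by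
    refine ⟨measurable_pi_lambda _ hz, ?_⟩
    rw [(iIndepFun_iff_map_fun_eq_pi_map fun i => (hz i).aemeasurable).1 hindep]
    simp only [hlaw]
  have hsplit := (measurePreserving_pi_split finSumFinEquiv Pz).comp hpi
  have hgood : {ω | Pz.real {x | x ∉ (p2lReach inv pref keep Ni (List.ofFn fun i => z i ω)).1.S} ≤
        epsBar (p2lReach inv pref keep Ni (List.ofFn fun i => z i ω)).2.length δ M} =
      (((fun w : Fin (Ni + M) → Fin n → ℝ => ((fun a => w (finSumFinEquiv (.inl a))),
        fun b => w (finSumFinEquiv (.inr b)))) ∘ fun ω i => z i ω) ⁻¹' bad)ᶜ := by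
    ext ω
    set x : Fin Ni → Fin n → ℝ := fun a => z (finSumFinEquiv (.inl a)) ω with hx
    set w : Fin M → Fin n → ℝ := fun b => z (finSumFinEquiv (.inr b)) ω with hw
    have hlist : (List.ofFn fun i => z i ω) = List.ofFn x ++ List.ofFn w := by
      rw [← List.ofFn_fin_append]
      congr 1
      funext i
      induction i using Fin.addCases with
      | left i => simp [hx]
      | right i => simp [hw]
    have htake : (List.ofFn fun i => z i ω).take Ni = List.ofFn x := by
      rw [hlist, List.take_left' (by simp)]
    have hdrop : (List.ofFn fun i => z i ω).drop Ni = List.ofFn w := by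
      rw [hlist, List.drop_left' (by simp)]
    obtain ⟨T, hT, hrun⟩ := p2l_isGreedyRun
      (fun T => christoffelSynth inv (if keep then List.ofFn x ++ T else T))
      inReachSet (dissatLE pref) (christoffelSynth inv (List.ofFn x)) (List.ofFn w)
      hrefl (fun h => dissatLE_trans h hpref_trans) (fun h => dissatLE_total h hpref_total)
      (inReachSet_christoffelSynth inv keep (List.ofFn x))
    have hrange : {y | y ∈ List.ofFn w} = Set.range w := by
      ext y
      exact List.mem_ofFn
    rw [hrange] at hrun
    have hrun : IsGreedyRun (R x) (le x) (Set.range w) T := hrun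
    have hp : p2lReach inv pref keep Ni (List.ofFn fun i => z i ω) =
        (reachDecisionAfter inv keep x T, T) := by
      rw [p2lReach, htake, hdrop]
      exact hT
    have hS : {y | y ∉ (reachDecisionAfter inv keep x T).S} = (R x T)ᶜ := rfl
    rw [Set.mem_ofPred_eq, hp, hS]
    change _ ↔ ¬ ∃ T', IsGreedyRun (R x) (le x) (Set.range w) T' ∧
      epsBar T'.length δ M < Pz.real (R x T')ᶜ
    constructor
    · rintro hle ⟨T', hT', hlt⟩
      obtain rfl := hrun.unique (fun S => dissatLE_antisymm _ hpref_antisymm) hT'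
      exact absurd hle (not_le.2 hlt)
    · intro hno
      by_contra! hlt
      exact hno ⟨T, hrun, hlt⟩
  rw [hgood, probReal_compl_eq_one_sub (hsplit.measurable hbad), Measure.real,
    hsplit.measure_preimage hbad.nullMeasurableSet]
  have := ENNReal.toReal_mono ENNReal.ofReal_ne_top hbad_le
  rw [ENNReal.toReal_ofReal hδ0.le] at this
  linarith
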